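/- **Setting.** Consider $N=N_A+N_B$ qubits, divided into a party A with $N_A$ qubits and a party B with $N_B$ qubits. Let $g_1,\dots,g_K$ be commuting generators, each a tensor product of operators from $\{\mathbb 1,X,Y,Z\}$ with a phase factor $\pm1$. They are independent ($\prod_k g_k^{s_k}=\mathbb 1$ exactly if all $s_k$ are even), and the group they generate does not contain $-\mathbb 1$. The corresponding (in general mixed) stabiliser state is $\rho=2^{-(N-K)}\prod_{k=1}^K\frac{\mathbb 1+g_k}{2}$. The stabiliser array has $K$ rows and $N$ columns, its entry $(k,n)$ being the $n$-th tensor factor of $g_k$; the phase factors are kept alongside. The elementary row operations are the exchange of two rows and the multiplication of one row into another. The local elementary column operations are the single-qubit Clifford operations that permute $X,Y,Z$ up to sign (the identity, $PH$, $HP^\dagger$, $PHP^\dagger$, $HPPHP^\dagger$ and $H$, where $H$ is the Hadamard gate and $P=\mathrm{diag}(1,i)$), the CNOT between two qubits of the same party, and the exchange of two columns of the same party. Let $\Psi=|\psi\rangle\langle\psi|$ with $\psi=(1,0,0,1)^T/\sqrt2$ denote the EPR state. An array is in *normal form with $p$ pairs* if $2p\le K$, $p\le N_A$, $p\le N_B$,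 and the following holds. For $i=1,\dots,p$, rows $2i-1$ and $2i$ contain $X$ and $Z$, respectively, in the $i$-th column of A and in the $i$-th column of B, and $\mathbb 1$ elsewhere. All remaining rows contain $\mathbb 1$ in the first $p$ columns of A and of B, and only $\mathbb 1$ or $X$ in the other columns. **Theorem.** (i) By a finite sequence of elementary row operations and local elementary column operations the stabiliser array can be brought into normal form with $p$ pairs for some $p$, with phase factor $+1$ in the first $2p$ rows. (ii) Let an array in normal form with $p$ pairs be obtained in this way. Its stabiliser state is the tensor product of $p$ two-qubit states and the stabiliser state $\rho'$ of the remaining qubits that is described by the lower rows. The $i$-th two-qubit state lives on the $i$-th qubit of A and the $i$-th qubit of B, and equals $\frac{\mathbb 1+s_iX\otimes X}{2}\,\frac{\mathbb 1+t_iZ\otimes Z}{2}$, where $s_i,t_i=\pm1$ are the phase factors of the $i$-th pair of rows. It is a pure maximally entangled state: it is equivalent to $\Psi$ under local unitaries, and equal to $\Psi$ if $s_i=t_i=1$. The state $\rho'$ is diagonal in the product basis of eigenvectors of the operators $X$, and it is separable. (iii) For every such normal form, $\rho$ is equivalent under local unitaries to $\Psi^{\otimes p}\otimes\rho'$. For every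 entanglement measure $E$ (a real function of the states of finite-dimensional bipartite systems that vanishes on separable states and does not increase under local operations and classical communication) that is additive, $E(\sigma^{\otimes n})=nE(\sigma)$, one has $E(\rho)=p\,E(\Psi)$. Moreover $p\le\min(\lfloor K/2\rfloor,N_A,N_B)$. If $p=\lfloor K/2\rfloor=N_A=N_B$, then $K=2N_A=2N_B$. For all values of $N_A$, $N_B$, $K$ for which generators as above exist, the bound is attained: some generators have a stabiliser array in normal form with $\min(\lfloor K/2\rfloor,N_A,N_B)$ pairs. -/

import Mathlib

open scoped Kronecker Matrix ComplexOrder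

noncomputable section

/-! ## Pauli operators and stabiliser operators -/

/-- The identity and the three Pauli operators: the possible entries of a stabiliser array. -/
inductive Pauli where
  | I | X | Y | Z
  deriving DecidableEq

namespace Pauli

/-- The 2 by 2 matrix of a Pauli operator. -/
def toMatrix : Pauli → Matrix (Fin 2) (Fin 2) ℂ
  | I => 1
  | X => !![0, 1; 1, 0]
  | Y => !![0, -Complex.I; Complex.I, 0]
  | Z => !![1, 0; 0, -1]

/-- The multiplication table of the Pauli operators: `σ * τ = i ^ m • υ` for `mul σ τ = (m, υ)`. -/
def mul : Pauli → Pauli → ZMod 4 × Pauli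
  | I, τ => (0, τ)
  | X, I => (0, X)
  | X, X => (0, I)
  | X, Y => (1, Z)
  | X, Z => (3, Y)
  | Y, I => (0, Y)
  | Y, X => (3, Z)
  | Y, Y => (0, I)
  | Y, Z => (1, X)
  | Z, I => (0, Z)
  | Z, X => (1, Y)
  | Z, Y => (3, X)
  | Z, Z => (0, I)

end Pauli

/-- The single-qubit column operations, named after the unitaries that implement them
(`H` Hadamard, `P` phase gate, `Pd` the inverse of `P`). -/
inductive QubitGate where
  | one | PH | HPd | PHPd | HPPHPd | H

/-- The truth table of the single-qubit column operations: the images of the Pauli operators, with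
their signs written as powers of `i`. -/
def QubitGate.act : QubitGate → Pauli → ZMod 4 × Pauli
  | _, .I => (0, .I)
  | one, τ => (0, τ)
  | PH, .X => (0, .Z)
  | PH, .Y => (0, .X)
  | PH, .Z => (0, .Y)
  | HPd, .X => (0, .Y)
  | HPd, .Y => (0, .Z)
  | HPd, .Z => (0, .X)
  | PHPd, .X => (2, .X)
  | PHPd, .Y => (0, .Z)
  | PHPd, .Z => (0, .Y)
  | HPPHPd, .X => (0, .Y)
  | HPPHPd, .Y => (0, .X)
  | HPPHPd, .Z => (2, .Z)
  | H, .X => (0, .Z)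
  | H, .Y => (2, .Y)
  | H, .Z => (0, .X)

/-- The truth table of the CNOT gate: `cnotTable C T = (m, C', T')` says that `C ⊗ T` (control
first) is mapped to `i ^ m • C' ⊗ T'`. -/
def cnotTable : Pauli → Pauli → ZMod 4 × Pauli × Pauli
  | .I, .I => (0, .I, .I)
  | .I, .X => (0, .I, .X)
  | .I, .Y => (0, .Z, .Y)
  | .I, .Z => (0, .Z, .Z)
  | .X, .I => (0, .X, .X)
  | .X, .X => (0, .X, .I)
  | .X, .Y => (0, .Y, .Z)
  | .X, .Z => (2, .Y, .Y)
  | .Y, .I => (0, .Y, .X)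
  | .Y, .X => (0, .Y, .I)
  | .Y, .Y => (2, .X, .Z)
  | .Y, .Z => (0, .X, .Y)
  | .Z, .I => (0, .Z, .I)
  | .Z, .X => (0, .Z, .X)
  | .Z, .Y => (0, .I, .Y)
  | .Z, .Z => (0, .I, .Z)

/-- The qubits of a system of `NA` qubits at A and `NB` qubits at B. -/
abbrev Qubit (NA NB : ℕ) : Type := Fin NA ⊕ Fin NB

/-- The position of a qubit inside its party, counted from 0. -/
def Qubit.pos {NA NB : ℕ} : Qubit NA NB → ℕ
  | .inl i => i
  | .inr j => j

/-- Two qubits that belong to the same party. -/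
def Qubit.SameParty {NA NB : ℕ} (q r : Qubit NA NB) : Prop := q.isLeft = r.isLeft

/-- The computational basis of `n` qubits. -/
abbrev Bits (n : ℕ) : Type := Fin n → Fin 2

/-- A tensor product of Pauli operators with a phase factor `i ^ phase`. -/
@[ext] structure StabOp (NA NB : ℕ) where
  phase : ZMod 4
  op : Qubit NA NB → Pauli

namespace StabOp

variable {NA NB : ℕ}

/-- The operator on the Hilbert space of the bipartite system. -/
def toMatrix (g : StabOp NA NB) : Matrix (Bits NA × Bits NB) (Bits NA × Bits NB) ℂ :=
  Matrix.of fun x y => Complex.I ^ g.phase.val *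
    ∏ q : Qubit NA NB, (g.op q).toMatrix (Sum.elim x.1 x.2 q) (Sum.elim y.1 y.2 q)

/-- The elementwise product of two rows of an array, with its phase. -/
def mul (g h : StabOp NA NB) : StabOp NA NB where
  phase := g.phase + h.phase + ∑ q, (Pauli.mul (g.op q) (h.op q)).1
  op q := (Pauli.mul (g.op q) (h.op q)).2

/-- A single-qubit column operation on qubit `q`, for one row. -/
def applyGate (u : QubitGate) (q : Qubit NA NB) (g : StabOp NA NB) : StabOp NA NB where
  phase := g.phase + (u.act (g.op q)).1
  op := Function.update g.op q (u.act (g.op q)).2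

/-- The CNOT with control `c` and target `t`, for one row. -/
def applyCNOT (c t : Qubit NA NB) (g : StabOp NA NB) : StabOp NA NB where
  phase := g.phase + (cnotTable (g.op c) (g.op t)).1
  op := Function.update (Function.update g.op c (cnotTable (g.op c) (g.op t)).2.1)
    t (cnotTable (g.op c) (g.op t)).2.2

/-- The transposition of the columns `q` and `r`, for one row. -/
def swapColumns (q r : Qubit NA NB) (g : StabOp NA NB) : StabOp NA NB where
  phase := g.phase
  op := g.op ∘ Equiv.swap q r

end StabOp

/-! ## Stabiliser arrays -/

/-- A stabiliser array with `K` rows (with their phases), `NA` columns for party A and `NB` columns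
for party B. -/
abbrev StabArray (NA NB K : ℕ) : Type := Fin K → StabOp NA NB

namespace StabArray

variable {NA NB K : ℕ}

/-- `K` independent commuting generators: stabiliser operators with phases `1` or `-1` that commute,
of which a product of powers is the identity exactly if all exponents are even, and whose stabiliser
group does not contain `-1` (otherwise there is no state that they stabilise). -/
structure IsGeneratorSet (G : StabArray NA NB K) : Prop where
  phase_real : ∀ k, (G k).phase = 0 ∨ (G k).phase = 2
  commute : ∀ k l, Commute (G k).toMatrix (G l).toMatrix
  independent : ∀ s : Fin K → ℕ,
    (List.ofFn fun k => (G k).toMatrix ^ s k).prod = 1 ↔ ∀ k, Even (s k)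
  ne_neg_one : ∀ s : Fin K → ℕ, (List.ofFn fun k => (G k).toMatrix ^ s k).prod ≠ -1

/-- The stabiliser state `2 ^ (-(N - K)) • ∏ k, (1 + g k) / 2`. -/
def state (G : StabArray NA NB K) : Matrix (Bits NA × Bits NB) (Bits NA × Bits NB) ℂ :=
  (2 : ℂ) ^ ((K : ℤ) - ((NA + NB : ℕ) : ℤ)) •
    (List.ofFn fun k => (2⁻¹ : ℂ) • (1 + (G k).toMatrix)).prod

/-- One elementary operation on a stabiliser array: a row operation, or a column operation that is
local with respect to the division into the parties A and B. -/
inductive Step : StabArray NA NB K → StabArray NA NB K → Prop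
  | rowSwap (G : StabArray NA NB K) (k l : Fin K) : Step G (G ∘ Equiv.swap k l)
  | rowMul (G : StabArray NA NB K) (k l : Fin K) (hkl : k ≠ l) :
      Step G (Function.update G l ((G k).mul (G l)))
  | gate (G : StabArray NA NB K) (u : QubitGate) (q : Qubit NA NB) :
      Step G (fun k => (G k).applyGate u q)
  | cnot (G : StabArray NA NB K) (c t : Qubit NA NB) (hct : c ≠ t) (hp : c.SameParty t) :
      Step G (fun k => (G k).applyCNOT c t)
  | colSwap (G : StabArray NA NB K) (q r : Qubit NA NB) (hp : q.SameParty r) :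
      Step G (fun k => (G k).swapColumns q r)

/-- A finite sequence of elementary operations leads from the first array to the second. -/
def Reaches : StabArray NA NB K → StabArray NA NB K → Prop := Relation.ReflTransGen Step

/-- The normal form with `p` row pairs. With rows and columns counted from 0, rows `2 * i` and
`2 * i + 1` (`i < p`) hold `X` and `Z` in column `i` of A and in column `i` of B and the identity
elsewhere; all other rows hold the identity in the first `p` columns of A and B, and only
identities and `X` elsewhere. -/
structure NormalForm (p : ℕ) (G : StabArray NA NB K) : Prop where
  two_mul_le : 2 * p ≤ K
  le_A : p ≤ NA
  le_B : p ≤ NB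
  pair_rows : ∀ (k : Fin K) (q : Qubit NA NB), (k : ℕ) < 2 * p →
    (G k).op q = if q.pos = (k : ℕ) / 2 then (if (k : ℕ) % 2 = 0 then .X else .Z) else .I
  lower_left : ∀ (k : Fin K) (q : Qubit NA NB), 2 * p ≤ (k : ℕ) → q.pos < p → (G k).op q = .I
  lower_right : ∀ (k : Fin K) (q : Qubit NA NB), 2 * p ≤ (k : ℕ) → p ≤ q.pos →
    (G k).op q = .I ∨ (G k).op q = .X

/-- The phase of the `X` row (`r = 0`) or the `Z` row (`r = 1`) of the pair `i`. -/
def pairPhase {p : ℕ} (hp : 2 * p ≤ K) (G : StabArray NA NB K) (i : Fin p) (r : Fin 2) : ZMod 4 :=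
  (G ⟨2 * i + r, by omega⟩).phase

/-- The lower right blocks of an array: the rows from `2 * p` on, restricted to the columns from `p`
on of each party. -/
def lowerBlock (p : ℕ) (G : StabArray NA NB K) : StabArray (NA - p) (NB - p) (K - 2 * p) :=
  fun k =>
    { phase := (G ⟨2 * p + k, by omega⟩).phase
      op := fun q => match q with
        | .inl i => (G ⟨2 * p + k, by omega⟩).op (.inl ⟨p + i, by omega⟩)
        | .inr j => (G ⟨2 * p + k, by omega⟩).op (.inr ⟨p + j, by omega⟩) }

end StabArray

/-! ## Bipartite states -/

/-- Density matrices. -/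
def IsDensity {a : Type} [Fintype a] (ρ : Matrix a a ℂ) : Prop :=
  ρ.PosSemidef ∧ ρ.trace = 1

/-- Separable states: finite convex combinations of product states. -/
def IsSeparableState {a b : Type} [Fintype a] [Fintype b] (ρ : Matrix (a × b) (a × b) ℂ) : Prop :=
  ∃ (n : ℕ) (w : Fin n → ℝ) (σ : Fin n → Matrix a a ℂ) (τ : Fin n → Matrix b b ℂ),
    (∀ i, 0 ≤ w i) ∧ ∑ i, w i = 1 ∧ (∀ i, IsDensity (σ i)) ∧ (∀ i, IsDensity (τ i)) ∧
      ρ = ∑ i, (w i : ℂ) • (σ i ⊗ₖ τ i)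

/-- Equivalence under local unitaries. The unitaries may go between different bases (index types)
of spaces of the same dimension. -/
def LocallyEquivalent {a b a' b' : Type} [Fintype a] [DecidableEq a] [Fintype b] [DecidableEq b]
    [Fintype a'] [DecidableEq a'] [Fintype b'] [DecidableEq b']
    (ρ : Matrix (a × b) (a × b) ℂ) (ρ' : Matrix (a' × b') (a' × b') ℂ) : Prop :=
  ∃ (U : Matrix a' a ℂ) (V : Matrix b' b ℂ), Uᴴ * U = 1 ∧ U * Uᴴ = 1 ∧ Vᴴ * V = 1 ∧ V * Vᴴ = 1 ∧
    ρ' = (U ⊗ₖ V) * ρ * (U ⊗ₖ V)ᴴ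

/-- The tensor product of two bipartite states, as a bipartite state. -/
def biTensor {a b a' b' : Type} (ρ : Matrix (a × b) (a × b) ℂ)
    (σ : Matrix (a' × b') (a' × b') ℂ) :
    Matrix ((a × a') × (b × b')) ((a × a') × (b × b')) ℂ :=
  Matrix.of fun x y =>
    ρ (x.1.1, x.2.1) (y.1.1, y.2.1) * σ (x.1.2, x.2.2) (y.1.2, y.2.2)

/-- The tensor product of `n` bipartite states, as a bipartite state. -/
def biProd {a b : Type} {n : ℕ} (ρ : Fin n → Matrix (a × b) (a × b) ℂ) :
    Matrix ((Fin n → a) × (Fin n → b)) ((Fin n → a) × (Fin n → b)) ℂ :=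
  Matrix.of fun x y => ∏ i, ρ i (x.1 i, x.2 i) (y.1 i, y.2 i)

/-- `n` copies of a bipartite state. -/
def biPow {a b : Type} (n : ℕ) (ρ : Matrix (a × b) (a × b) ℂ) :
    Matrix ((Fin n → a) × (Fin n → b)) ((Fin n → a) × (Fin n → b)) ℂ :=
  biProd fun _ => ρ

/-- The state vector `(1, 0, 0, 1) / √2` of two qubits. -/
def eprVec (x : Fin 2 × Fin 2) : ℂ := if x.1 = x.2 then ((√2 : ℝ) : ℂ)⁻¹ else 0

/-- The EPR state. -/
def EPR : Matrix (Fin 2 × Fin 2) (Fin 2 × Fin 2) ℂ := Matrix.vecMulVec eprVec (star eprVec)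

/-- The two-qubit state with the generators `i ^ s • X ⊗ X` and `i ^ t • Z ⊗ Z`. -/
def pairState (s t : ZMod 4) : Matrix (Fin 2 × Fin 2) (Fin 2 × Fin 2) ℂ :=
  ((2⁻¹ : ℂ) • (1 + Complex.I ^ s.val • (Pauli.X.toMatrix ⊗ₖ Pauli.X.toMatrix))) *
    ((2⁻¹ : ℂ) • (1 + Complex.I ^ t.val • (Pauli.Z.toMatrix ⊗ₖ Pauli.Z.toMatrix)))

/-- Puts together the first `p` and the last `n - p` bits of a string of `n` bits. -/
def joinBits {p n : ℕ} (x : Bits p × Bits (n - p)) : Bits n := fun i =>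
  if h : (i : ℕ) < p then x.1 ⟨i, h⟩ else x.2 ⟨i - p, by omega⟩

/-- A state of `NA + NB` qubits, in which the first `p` qubits of each party are separated from the
other ones. -/
def splitQubits {NA NB : ℕ} (p : ℕ) (ρ : Matrix (Bits NA × Bits NB) (Bits NA × Bits NB) ℂ) :
    Matrix ((Bits p × Bits (NA - p)) × (Bits p × Bits (NB - p)))
      ((Bits p × Bits (NA - p)) × (Bits p × Bits (NB - p))) ℂ :=
  ρ.submatrix (Prod.map joinBits joinBits) (Prod.map joinBits joinBits)

/-- The Hadamard gate on each of `n` qubits; its columns are the product basis in which every `X` is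
diagonal. -/
def hadamardAll (n : ℕ) : Matrix (Bits n) (Bits n) ℂ :=
  Matrix.of fun x y => ∏ i, (((√2 : ℝ) : ℂ)⁻¹ • !![(1 : ℂ), 1; 1, -1]) (x i) (y i)

/-- States that are diagonal in the product basis of eigenvectors of the operators `X`. -/
def IsXDiagonal {m n : ℕ} (ρ : Matrix (Bits m × Bits n) (Bits m × Bits n) ℂ) : Prop :=
  ((hadamardAll m ⊗ₖ hadamardAll n)ᴴ * ρ * (hadamardAll m ⊗ₖ hadamardAll n)).IsDiag

/-! ## Entanglement measures -/

/-- Channels in which A performs a measurement with Kraus operators `A k`, tells B the outcome, and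
B applies the channel with Kraus operators `B k l`. -/
def IsOneWayAB {a b a' b' : Type} [Fintype a] [DecidableEq a] [Fintype b] [DecidableEq b]
    [Fintype a'] [Fintype b']
    (Λ : Matrix (a × b) (a × b) ℂ → Matrix (a' × b') (a' × b') ℂ) : Prop :=
  ∃ (m n : ℕ) (A : Fin m → Matrix a' a ℂ) (B : Fin m → Fin n → Matrix b' b ℂ),
    ∑ k, (A k)ᴴ * A k = 1 ∧ (∀ k, ∑ l, (B k l)ᴴ * B k l = 1) ∧
      ∀ ρ, Λ ρ = ∑ k, ∑ l, (A k ⊗ₖ B k l) * ρ * (A k ⊗ₖ B k l)ᴴ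

/-- The same with the roles of A and B exchanged. -/
def IsOneWayBA {a b a' b' : Type} [Fintype a] [DecidableEq a] [Fintype b] [DecidableEq b]
    [Fintype a'] [Fintype b']
    (Λ : Matrix (a × b) (a × b) ℂ → Matrix (a' × b') (a' × b') ℂ) : Prop :=
  ∃ (m n : ℕ) (A : Fin m → Fin n → Matrix a' a ℂ) (B : Fin m → Matrix b' b ℂ),
    ∑ k, (B k)ᴴ * B k = 1 ∧ (∀ k, ∑ l, (A k l)ᴴ * A k l = 1) ∧
      ∀ ρ, Λ ρ = ∑ k, ∑ l, (A k l ⊗ₖ B k) * ρ * (A k l ⊗ₖ B k)ᴴ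

/-- LOCC channels (local operations and classical communication): finite sequences of one-way
channels. The parties keep the record of earlier outcomes in their own systems, which may change
from round to round. -/
inductive IsLOCC : ∀ {a b a' b' : Type},
    (Matrix (a × b) (a × b) ℂ → Matrix (a' × b') (a' × b') ℂ) → Prop
  | oneWayAB {a b a' b' : Type} [Fintype a] [DecidableEq a] [Fintype b] [DecidableEq b]
      [Fintype a'] [Fintype b']
      (Λ : Matrix (a × b) (a × b) ℂ → Matrix (a' × b') (a' × b') ℂ) (h : IsOneWayAB Λ) : IsLOCC Λ
  | oneWayBA {a b a' b' : Type} [Fintype a] [DecidableEq a] [Fintype b] [DecidableEq b]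
      [Fintype a'] [Fintype b']
      (Λ : Matrix (a × b) (a × b) ℂ → Matrix (a' × b') (a' × b') ℂ) (h : IsOneWayBA Λ) : IsLOCC Λ
  | comp {a b a' b' a'' b'' : Type}
      (Λ : Matrix (a × b) (a × b) ℂ → Matrix (a' × b') (a' × b') ℂ)
      (Λ' : Matrix (a' × b') (a' × b') ℂ → Matrix (a'' × b'') (a'' × b'') ℂ)
      (h : IsLOCC Λ) (h' : IsLOCC Λ') : IsLOCC (Λ' ∘ Λ)

/-- A real function of the states of all finite-dimensional bipartite systems (its values on other
arguments are irrelevant). -/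
abbrev BipartiteFunction : Type 1 := ∀ a b : Type, Matrix (a × b) (a × b) ℂ → ℝ

/-- Entanglement measures: functions that vanish on separable states and do not increase under
LOCC. -/
structure IsEntanglementMeasure (E : BipartiteFunction) : Prop where
  separable : ∀ (a b : Type) [Fintype a] [Fintype b] (ρ : Matrix (a × b) (a × b) ℂ),
    IsSeparableState ρ → E a b ρ = 0
  locc : ∀ (a b a' b' : Type) [Fintype a] [Fintype b] [Fintype a'] [Fintype b']
    (Λ : Matrix (a × b) (a × b) ℂ → Matrix (a' × b') (a' × b') ℂ), IsLOCC Λ →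
      ∀ ρ, IsDensity ρ → E a' b' (Λ ρ) ≤ E a b ρ

/-- Additivity: `n` copies of a state have `n` times its entanglement. -/
def IsAdditive (E : BipartiteFunction) : Prop :=
  ∀ (a b : Type) [Fintype a] [Fintype b] (ρ : Matrix (a × b) (a × b) ℂ), IsDensity ρ →
    ∀ n : ℕ, E _ _ (biPow n ρ) = n * E a b ρ

end

/-! Up to phases, the rows of an array are vectors over the field with two elements, and commutation
is the symplectic form `StabOp.form`, which splits into a part at A and a part at B. Column
operations inside a party preserve the form of that party. The rows commute, so the parts at A and B
agree for every pair of rows.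

Suppose two rows anticommute at A. Then they also anticommute at B, and a symplectic reduction
inside each party (`exists_reduce_pair`) turns them into `X`, `Z` in one column of A and one column
of B. Multiplying them into the other rows clears the column at A. The column at B is then trivial
as well, since the other rows still commute with both (`PartialForm.exists_succ`). When no such rows
are left, the remaining rows commute inside A and inside B, and an isotropic family can be brought
to entries `1` and `X` by column operations (`exists_reduce_commuting`). This gives
`IsCommuting.exists_normalForm`.

For the states, column operations are conjugations by local unitaries, and row operations do not
change the product of projectors, because `(1 + g)(1 + gh) = (1 + g)(1 + h)` if `g² = 1`. Hence
every reachable array has a locally equivalent state (`IsCommuting.locallyEquivalent_reaches`). In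
normal form the product of projectors factorises over pairs and lower block
(`NormalForm.splitQubits_state`). Hadamard gates diagonalise the lower state with weights that are
zero or one fixed power of 2 (`exists_weights`). The trace of the original state is 1, because
nontrivial products of generators are traceless (`IsGeneratorSet.trace_state`). This passes to the
lower block, so its weights are probabilities and its state is a mixture of product states. A
nonzero weight is at most 1, which yields `K ≤ NA + NB` (`card_rows_le`).

A product mixture can be adjoined by shared randomness and discarded by partial traces, both of
which are LOCC (`le_biTensor`, `biTensor_le`). Thus `E` sees only the EPR pairs, and additivity
counts them. The bound on `p` is part of the normal form; `standardForm` attains it, and its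
independence is certified by one-qubit operators that each anticommute with exactly one row. -/

/-! ## Commutation of stabiliser operators -/

/-- Whether two Pauli operators anticommute. -/
def Pauli.anti (a b : Pauli) : ZMod 2 := if a = .I ∨ b = .I ∨ a = b then 0 else 1

namespace Pauli

lemma anti_comm (a b : Pauli) : a.anti b = b.anti a := by cases a <;> cases b <;> rfl

@[simp] lemma anti_self (a : Pauli) : a.anti a = 0 := by cases a <;> rfl

@[simp] lemma anti_I_left (a : Pauli) : anti .I a = 0 := by cases a <;> rfl

@[simp] lemma anti_I_right (a : Pauli) : a.anti .I = 0 := by cases a <;> rfl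

/-- Modulo phases the Pauli operators form a two-dimensional space over the field with two elements,
and `anti` is its symplectic form; this is its bilinearity. -/
lemma mul_anti (a b c : Pauli) : (mul a b).2.anti c = a.anti c + b.anti c := by
  cases a <;> cases b <;> cases c <;> rfl

/-- The reduction of powers of `i` to even and odd ones. -/
def parity : ZMod 4 →+* ZMod 2 := ZMod.castHom (by norm_num) _

lemma parity_eq_zero_iff (x : ZMod 4) : parity x = 0 ↔ x = 0 ∨ x = 2 := by
  revert x; decide

/-- Distinct nontrivial Pauli operators multiply to `±i` times the third one; all other products are
real. Summed over the columns, this keeps phases real when commuting rows are multiplied. -/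
lemma parity_mul (a b : Pauli) : parity (mul a b).1 = a.anti b := by
  cases a <;> cases b <;> rfl

lemma eq_I_or_X {a : Pauli} (h : a.anti .X = 0) : a = .I ∨ a = .X := by
  revert h; cases a <;> decide

lemma eq_I_of_anti {a : Pauli} (h : a.anti .X = 0) (h' : a.anti .Z = 0) : a = .I := by
  revert h h'; cases a <;> decide

end Pauli

lemma QubitGate.anti_act (u : QubitGate) (a b : Pauli) :
    (u.act a).2.anti (u.act b).2 = a.anti b := by
  cases u <;> cases a <;> cases b <;> rfl

lemma QubitGate.parity_act (u : QubitGate) (a : Pauli) : Pauli.parity (u.act a).1 = 0 := by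
  cases u <;> cases a <;> rfl

@[simp] lemma QubitGate.act_I (u : QubitGate) : u.act .I = (0, .I) := by cases u <;> rfl

/-- The CNOT is symplectic only on control and target together. Hence `form_applyCNOT` needs both of
them in the column set. -/
lemma anti_cnotTable (a b c d : Pauli) :
    (cnotTable a b).2.1.anti (cnotTable c d).2.1 + (cnotTable a b).2.2.anti (cnotTable c d).2.2 =
      a.anti c + b.anti d := by
  cases a <;> cases b <;> cases c <;> cases d <;> rfl

lemma parity_cnotTable (a b : Pauli) : Pauli.parity (cnotTable a b).1 = 0 := by
  cases a <;> cases b <;> rfl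

namespace StabOp

variable {NA NB : ℕ}

/-- The number modulo 2 of the columns in `S` in which two rows anticommute. -/
def form (S : Finset (Qubit NA NB)) (g h : StabOp NA NB) : ZMod 2 :=
  ∑ q ∈ S, (g.op q).anti (h.op q)

lemma form_comm (S : Finset (Qubit NA NB)) (g h : StabOp NA NB) : form S g h = form S h g :=
  Finset.sum_congr rfl fun _ _ => Pauli.anti_comm _ _

@[simp] lemma form_self (S : Finset (Qubit NA NB)) (g : StabOp NA NB) : form S g g = 0 := by
  simp [form]

lemma form_mul_left (S : Finset (Qubit NA NB)) (g h k : StabOp NA NB) :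
    form S (g.mul h) k = form S g k + form S h k := by
  simp [form, mul, Pauli.mul_anti, Finset.sum_add_distrib]

lemma parity_mul (g h : StabOp NA NB) : Pauli.parity (g.mul h).phase =
    Pauli.parity g.phase + Pauli.parity h.phase + form Finset.univ g h := by
  simp [mul, form, Pauli.parity_mul]

lemma form_congr {S : Finset (Qubit NA NB)} {g g' h h' : StabOp NA NB}
    (hg : ∀ q ∈ S, g.op q = g'.op q) (hh : ∀ q ∈ S, h.op q = h'.op q) :
    form S g h = form S g' h' :=
  Finset.sum_congr rfl fun q hq => by rw [hg q hq, hh q hq]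

lemma form_applyGate (S : Finset (Qubit NA NB)) (u : QubitGate) (q : Qubit NA NB)
    (g h : StabOp NA NB) : form S (g.applyGate u q) (h.applyGate u q) = form S g h := by
  refine Finset.sum_congr rfl fun r _ => ?_
  by_cases hr : r = q
  · subst hr; simp [applyGate, QubitGate.anti_act]
  · simp [applyGate, hr]

lemma form_applyCNOT {S : Finset (Qubit NA NB)} {c t : Qubit NA NB} (hct : c ≠ t) (hc : c ∈ S)
    (ht : t ∈ S) (g h : StabOp NA NB) :
    form S (g.applyCNOT c t) (h.applyCNOT c t) = form S g h := by
  have hsub : ({c, t} : Finset (Qubit NA NB)) ⊆ S := by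
    intro x hx; simp at hx; rcases hx with rfl | rfl <;> assumption
  unfold form
  rw [← Finset.sum_sdiff hsub, ← Finset.sum_sdiff hsub, Finset.sum_pair hct, Finset.sum_pair hct]
  congr 1
  · refine Finset.sum_congr rfl fun r hr => ?_
    simp at hr
    have h1 : r ≠ c := by tauto
    have h2 : r ≠ t := by tauto
    simp [applyCNOT, h1, h2]
  · simpa [applyCNOT, hct] using anti_cnotTable _ _ _ _

lemma form_swapColumns {S : Finset (Qubit NA NB)} {q r : Qubit NA NB} (hq : q ∈ S) (hr : r ∈ S)
    (g h : StabOp NA NB) : form S (g.swapColumns q r) (h.swapColumns q r) = form S g h := by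
  refine Finset.sum_equiv (Equiv.swap q r) (fun x => ?_) (fun _ _ => rfl)
  by_cases h1 : x = q
  · subst h1; simp [hq, hr]
  · by_cases h2 : x = r
    · subst h2; simp [hq, hr]
    · rw [Equiv.swap_apply_of_ne_of_ne h1 h2]

end StabOp

/-! ### Commuting arrays and their stability under elementary operations -/

namespace StabArray

variable {NA NB K : ℕ}

/-- Rows with real phases that commute with each other. -/
structure IsCommuting (G : StabArray NA NB K) : Prop where
  parity : ∀ k, Pauli.parity (G k).phase = 0
  form : ∀ k l, StabOp.form Finset.univ (G k) (G l) = 0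

lemma IsCommuting.step {G G' : StabArray NA NB K} (hG : G.IsCommuting) (h : Step G G') :
    G'.IsCommuting := by
  cases h with
  | rowSwap k l => exact ⟨fun _ => hG.parity _, fun _ _ => hG.form _ _⟩
  | rowMul k l hkl =>
    -- Only the first argument is updated here. The update in the second argument is expanded
    -- afterwards by symmetry, and each of the two terms is an instance of this statement.
    have key : ∀ m n, StabOp.form Finset.univ (Function.update G l ((G k).mul (G l)) m) (G n) =
        0 := by
      intro m n
      by_cases hm : m = l
      · subst hm; simp [StabOp.form_mul_left, hG.form]
      · simp [hm, hG.form]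
    refine ⟨fun m => ?_, fun m n => ?_⟩
    · by_cases hm : m = l
      · subst hm; simp [StabOp.parity_mul, hG.form, hG.parity]
      · simp [hm, hG.parity]
    · by_cases hn : n = l
      · subst hn
        rw [Function.update_self, StabOp.form_comm, StabOp.form_mul_left, StabOp.form_comm,
          key, StabOp.form_comm, key, add_zero]
      · rw [Function.update_of_ne hn]; exact key m n
  | gate u q =>
    exact ⟨fun k => by simp [StabOp.applyGate, hG.parity, QubitGate.parity_act],
      fun k l => by rw [StabOp.form_applyGate, hG.form]⟩
  | cnot c t hct hp =>
    exact ⟨fun k => by simp [StabOp.applyCNOT, hG.parity, parity_cnotTable],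
      fun k l => by rw [StabOp.form_applyCNOT hct (by simp) (by simp), hG.form]⟩
  | colSwap q r hp =>
    exact ⟨fun k => hG.parity k,
      fun k l => by rw [StabOp.form_swapColumns (by simp) (by simp), hG.form]⟩

lemma IsCommuting.reaches {G G' : StabArray NA NB K} (hG : G.IsCommuting) (h : G.Reaches G') :
    G'.IsCommuting := by
  induction h with
  | refl => exact hG
  | tail _ h ih => exact ih.step h

/-! ## Column operations inside a set of columns -/

/-- The second array arises from the first one by operations on the columns in `S`. -/
structure ColEquiv (S : Finset (Qubit NA NB)) (G G' : StabArray NA NB K) : Prop where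
  reaches : G.Reaches G'
  form : ∀ k l, StabOp.form S (G' k) (G' l) = StabOp.form S (G k) (G l)
  op_eq : ∀ k, ∀ q ∉ S, (G' k).op q = (G k).op q
  eq_of_trivial : ∀ k, (∀ q ∈ S, (G k).op q = .I) → G' k = G k

namespace ColEquiv

variable {S T : Finset (Qubit NA NB)} {G G' G'' : StabArray NA NB K}

lemma refl (S : Finset (Qubit NA NB)) (G : StabArray NA NB K) : ColEquiv S G G :=
  ⟨.refl, fun _ _ => rfl, fun _ _ _ => rfl, fun _ _ => rfl⟩

lemma trans (h : ColEquiv S G G') (h' : ColEquiv S G' G'') : ColEquiv S G G'' where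
  reaches := Relation.ReflTransGen.trans h.reaches h'.reaches
  form k l := (h'.form k l).trans (h.form k l)
  op_eq k q hq := (h'.op_eq k q hq).trans (h.op_eq k q hq)
  eq_of_trivial k hk := by
    have := h.eq_of_trivial k hk
    rw [← this]
    exact h'.eq_of_trivial k (by rwa [this])

/-- Columns outside `S` are unchanged, so they contribute equally to both forms. This lets an
induction work on a shrinking set of columns. -/
lemma mono (h : ColEquiv S G G') (hST : S ⊆ T) : ColEquiv T G G' where
  reaches := h.reaches
  form k l := by
    unfold StabOp.form
    rw [← Finset.sum_sdiff hST, ← Finset.sum_sdiff hST]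
    congr 1
    · refine Finset.sum_congr rfl fun q hq => ?_
      have := (Finset.mem_sdiff.1 hq).2
      rw [h.op_eq k q this, h.op_eq l q this]
    · exact h.form k l
  op_eq k q hq := h.op_eq k q fun h' => hq (hST h')
  eq_of_trivial k hk := h.eq_of_trivial k fun q hq => hk q (hST hq)

lemma gate (G : StabArray NA NB K) (u : QubitGate) {q : Qubit NA NB} (hq : q ∈ S) :
    ColEquiv S G (fun k => (G k).applyGate u q) where
  reaches := .single (.gate G u q)
  form k l := StabOp.form_applyGate _ _ _ _ _
  op_eq k r hr := by
    have : r ≠ q := by rintro rfl; exact hr hq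
    simp [StabOp.applyGate, this]
  eq_of_trivial k hk := by
    ext r
    · simp [StabOp.applyGate, hk q hq]
    · by_cases hr : r = q
      · subst hr; simp [StabOp.applyGate, hk r hq]
      · simp [StabOp.applyGate, hr]

lemma cnot (G : StabArray NA NB K) {c t : Qubit NA NB} (hct : c ≠ t) (hp : c.SameParty t)
    (hc : c ∈ S) (ht : t ∈ S) : ColEquiv S G (fun k => (G k).applyCNOT c t) where
  reaches := .single (.cnot G c t hct hp)
  form k l := StabOp.form_applyCNOT hct hc ht _ _
  op_eq k r hr := by
    have h1 : r ≠ c := by rintro rfl; exact hr hc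
    have h2 : r ≠ t := by rintro rfl; exact hr ht
    simp [StabOp.applyCNOT, h1, h2]
  eq_of_trivial k hk := by
    have h0 : cnotTable ((G k).op c) ((G k).op t) = (0, .I, .I) := by rw [hk c hc, hk t ht]; rfl
    ext r
    · simp [StabOp.applyCNOT, h0]
    · by_cases h2 : r = t
      · subst h2; simp [StabOp.applyCNOT, hk r ht, hk c hc, cnotTable]
      · by_cases h1 : r = c
        · subst h1; simp [StabOp.applyCNOT, hk r hc, hk t ht, h2, cnotTable]
        · simp [StabOp.applyCNOT, h1, h2]

lemma colSwap (G : StabArray NA NB K) {q r : Qubit NA NB} (hp : q.SameParty r)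
    (hq : q ∈ S) (hr : r ∈ S) : ColEquiv S G (fun k => (G k).swapColumns q r) where
  reaches := .single (.colSwap G q r hp)
  form k l := StabOp.form_swapColumns hq hr _ _
  op_eq k x hx := by
    have h1 : x ≠ q := by rintro rfl; exact hx hq
    have h2 : x ≠ r := by rintro rfl; exact hx hr
    simp [StabOp.swapColumns, Equiv.swap_apply_of_ne_of_ne h1 h2]
  eq_of_trivial k hk := by
    ext x
    · rfl
    · by_cases h1 : x = q
      · subst h1; simp [StabOp.swapColumns, hk _ hq, hk _ hr]
      · by_cases h2 : x = r
        · subst h2; simp [StabOp.swapColumns, hk _ hq, hk _ hr]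
        · simp [StabOp.swapColumns, Equiv.swap_apply_of_ne_of_ne h1 h2]

end ColEquiv

/-- The identity and the two cyclic permutations already act transitively on `X`, `Y`, `Z`. -/
lemma exists_gate_act {a b : Pauli} (ha : a ≠ .I) (hb : b ≠ .I) :
    ∃ u : QubitGate, (u.act a).2 = b := by
  cases a <;> cases b <;> first
    | exact absurd rfl ha
    | exact absurd rfl hb
    | exact ⟨.one, rfl⟩
    | exact ⟨.PH, rfl⟩
    | exact ⟨.HPd, rfl⟩

/-- A row that is nontrivial in column `s` can be reduced to `X` in column `s`. -/
lemma exists_reduce_X {S : Finset (Qubit NA NB)} (hS : ∀ q ∈ S, ∀ r ∈ S, q.SameParty r)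
    (G : StabArray NA NB K) (k : Fin K) {s : Qubit NA NB} (hs : s ∈ S) (hk : (G k).op s ≠ .I) :
    ∃ G', ColEquiv S G G' ∧ ∀ q ∈ S, (G' k).op q = if q = s then .X else .I := by
  -- Columns are cleared one at a time: an entry is rotated to `X`, and the CNOT with control `s`
  -- sends `X ⊗ X` to `X ⊗ 1`.
  have main : ∀ T : Finset (Qubit NA NB), T ⊆ S.erase s →
      ∃ G', ColEquiv S G G' ∧ (G' k).op s = .X ∧ ∀ q ∈ T, (G' k).op q = .I := by
    intro T
    induction T using Finset.induction_on with
    | empty =>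
      intro _
      obtain ⟨u, hu⟩ := exists_gate_act hk (b := .X) (by decide)
      exact ⟨_, ColEquiv.gate G u hs, by simp [StabOp.applyGate, hu], by simp⟩
    | insert t T ht ih =>
      intro hT
      obtain ⟨G', h1, h2, h3⟩ := ih fun q hq => hT (Finset.mem_insert_of_mem hq)
      obtain ⟨hts, htS⟩ := Finset.mem_erase.1 (hT (Finset.mem_insert_self t T))
      by_cases h0 : (G' k).op t = .I
      · exact ⟨G', h1, h2, by simpa [h0] using h3⟩
      obtain ⟨u, hu⟩ := exists_gate_act h0 (b := .X) (by decide)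
      refine ⟨_, (h1.trans (ColEquiv.gate G' u htS)).trans
        (ColEquiv.cnot _ hts.symm (hS s hs t htS) hs htS), ?_, ?_⟩
      · simp [StabOp.applyGate, StabOp.applyCNOT, hu, h2, hts.symm, cnotTable]
      · intro q hq
        have hqs : q ≠ s := (Finset.mem_erase.1 (hT hq)).1
        by_cases hqt : q = t
        · subst hqt
          simp [StabOp.applyGate, StabOp.applyCNOT, hu, h2, hts.symm, cnotTable]
        · have := h3 q (Finset.mem_of_mem_insert_of_ne hq hqt)
          simp [StabOp.applyGate, StabOp.applyCNOT, hqt, hqs, this]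
  obtain ⟨G', h1, h2, h3⟩ := main _ subset_rfl
  refine ⟨G', h1, fun q hq => ?_⟩
  by_cases hqs : q = s
  · simp [hqs, h2]
  · simp [hqs, h3 q (Finset.mem_erase.2 ⟨hqs, hq⟩)]

/-- A row with `Z` in column `s` can be reduced to this entry without changing a row that is `X` in
column `s`. -/
lemma exists_reduce_Z {S : Finset (Qubit NA NB)} (hS : ∀ q ∈ S, ∀ r ∈ S, q.SameParty r)
    (G : StabArray NA NB K) (k l : Fin K) {s : Qubit NA NB} (hs : s ∈ S)
    (hk : ∀ q ∈ S, (G k).op q = if q = s then .X else .I) (hl : (G l).op s = .Z) :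
    ∃ G', ColEquiv S G G' ∧ (∀ q ∈ S, (G' k).op q = if q = s then .X else .I) ∧
      ∀ q ∈ S, (G' l).op q = if q = s then .Z else .I := by
  -- Here the CNOT has target `s`: it sends `Z ⊗ Z` to `1 ⊗ Z` and fixes `1 ⊗ X`, which is what row
  -- `k` holds in the two columns.
  have main : ∀ T : Finset (Qubit NA NB), T ⊆ S.erase s →
      ∃ G', ColEquiv S G G' ∧ (∀ q ∈ S, (G' k).op q = if q = s then .X else .I) ∧
        (G' l).op s = .Z ∧ ∀ q ∈ T, (G' l).op q = .I := by
    intro T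
    induction T using Finset.induction_on with
    | empty => exact fun _ => ⟨G, ColEquiv.refl _ _, hk, hl, by simp⟩
    | insert t T ht ih =>
      intro hT
      obtain ⟨G', h1, hk', h2, h3⟩ := ih fun q hq => hT (Finset.mem_insert_of_mem hq)
      obtain ⟨hts, htS⟩ := Finset.mem_erase.1 (hT (Finset.mem_insert_self t T))
      by_cases h0 : (G' l).op t = .I
      · exact ⟨G', h1, hk', h2, by simpa [h0] using h3⟩
      obtain ⟨u, hu⟩ := exists_gate_act h0 (b := .Z) (by decide)
      refine ⟨_, (h1.trans (ColEquiv.gate G' u htS)).trans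
        (ColEquiv.cnot _ hts (hS t htS s hs) htS hs), ?_, ?_, ?_⟩
      · intro q hq
        have hkt := hk' t htS
        have hks := hk' s hs
        have hkq := hk' q hq
        rw [if_neg hts] at hkt
        rw [if_pos rfl] at hks
        by_cases hqs : q = s
        · subst hqs
          simp [StabOp.applyGate, StabOp.applyCNOT, hkt, hks, hts.symm, cnotTable]
        · by_cases hqt : q = t
          · subst hqt
            simp [StabOp.applyGate, StabOp.applyCNOT, hkt, hks, hts, hts.symm, cnotTable]
          · simp [StabOp.applyGate, StabOp.applyCNOT, hqt, hqs, hkq]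
      · simp [StabOp.applyGate, StabOp.applyCNOT, hu, h2, hts.symm, cnotTable]
      · intro q hq
        have hqs : q ≠ s := (Finset.mem_erase.1 (hT hq)).1
        by_cases hqt : q = t
        · subst hqt
          simp [StabOp.applyGate, StabOp.applyCNOT, hu, h2, hts.symm, hts, cnotTable]
        · have := h3 q (Finset.mem_of_mem_insert_of_ne hq hqt)
          simp [StabOp.applyGate, StabOp.applyCNOT, hqt, hqs, this]
  obtain ⟨G', h1, hk', h2, h3⟩ := main _ subset_rfl
  refine ⟨G', h1, hk', fun q hq => ?_⟩
  by_cases hqs : q = s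
  · simp [hqs, h2]
  · simp [hqs, h3 q (Finset.mem_erase.2 ⟨hqs, hq⟩)]

lemma form_eq_of_single {S : Finset (Qubit NA NB)} {g h : StabOp NA NB} {s : Qubit NA NB}
    (hs : s ∈ S) {a : Pauli} (hg : ∀ q ∈ S, g.op q = if q = s then a else .I) :
    StabOp.form S g h = a.anti (h.op s) := by
  unfold StabOp.form
  rw [Finset.sum_eq_single_of_mem s hs]
  · simp [hg s hs]
  · intro q hq hqs
    simp [hg q hq, hqs]

/-- Two rows that anticommute on `S` can be reduced to `X` and `Z` in a column `s`. -/
lemma exists_reduce_pair {S : Finset (Qubit NA NB)} (hS : ∀ q ∈ S, ∀ r ∈ S, q.SameParty r)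
    (G : StabArray NA NB K) (k l : Fin K) {s : Qubit NA NB} (hs : s ∈ S)
    (hkl : StabOp.form S (G k) (G l) = 1) :
    ∃ G', ColEquiv S G G' ∧ (∀ q ∈ S, (G' k).op q = if q = s then .X else .I) ∧
      ∀ q ∈ S, (G' l).op q = if q = s then .Z else .I := by
  obtain ⟨r, hr, hkr⟩ : ∃ r ∈ S, (G k).op r ≠ .I := by
    by_contra! hc
    have : StabOp.form S (G k) (G l) = 0 := Finset.sum_eq_zero fun q hq => by simp [hc q hq]
    rw [this] at hkl
    exact absurd hkl (by decide)
  obtain ⟨G₁, e₁, h₁⟩ := exists_reduce_X hS G k hr hkr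
  obtain ⟨G₂, e₂, h₂⟩ : ∃ G₂, ColEquiv S G₁ G₂ ∧
      ∀ q ∈ S, (G₂ k).op q = if q = s then .X else .I := by
    refine ⟨_, ColEquiv.colSwap G₁ (hS r hr s hs) hr hs, fun q hq => ?_⟩
    by_cases hqs : q = s
    · subst hqs; simp [StabOp.swapColumns, h₁ r hr]
    · by_cases hqr : q = r
      · subst hqr
        simp [StabOp.swapColumns, h₁ s hs, Ne.symm hqs, hqs]
      · simp [StabOp.swapColumns, Equiv.swap_apply_of_ne_of_ne hqr hqs, h₁ q hq, hqr, hqs]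
  -- Row `k` is now supported on `s` within `S`, so the preserved form is read off from the single
  -- entry of row `l` there.
  have hform : Pauli.anti .X ((G₂ l).op s) = 1 := by
    rw [← form_eq_of_single hs h₂, e₂.form, e₁.form, hkl]
  have hcases : (G₂ l).op s = .Z ∨ (G₂ l).op s = .Y := by
    revert hform; cases (G₂ l).op s <;> decide
  obtain ⟨G₃, e₃, h₃, h₃'⟩ : ∃ G₃, ColEquiv S G₂ G₃ ∧
      (∀ q ∈ S, (G₃ k).op q = if q = s then .X else .I) ∧ (G₃ l).op s = .Z := by
    rcases hcases with h | h
    · exact ⟨G₂, ColEquiv.refl _ _, h₂, h⟩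
    -- This gate turns `Y` into `Z` and keeps `X` up to sign.
    · refine ⟨_, ColEquiv.gate G₂ .PHPd hs, fun q hq => ?_, ?_⟩
      · by_cases hqs : q = s
        · subst hqs; simp [StabOp.applyGate, h₂ q hq, QubitGate.act]
        · simp [StabOp.applyGate, hqs, h₂ q hq]
      · simp [StabOp.applyGate, h, QubitGate.act]
  obtain ⟨G₄, e₄, h₄, h₄'⟩ := exists_reduce_Z hS G₃ k l hs h₃ h₃'
  exact ⟨G₄, ((e₁.trans e₂).trans e₃).trans e₄, h₄, h₄'⟩

/-- Rows that commute with each other on `S` can be brought to rows with entries `1` and `X`. -/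
lemma exists_reduce_commuting {S : Finset (Qubit NA NB)} (hS : ∀ q ∈ S, ∀ r ∈ S, q.SameParty r)
    (R : Set (Fin K)) (G : StabArray NA NB K)
    (hR : ∀ k ∈ R, ∀ l ∈ R, StabOp.form S (G k) (G l) = 0) :
    ∃ G', ColEquiv S G G' ∧ ∀ k ∈ R, ∀ q ∈ S, (G' k).op q = .I ∨ (G' k).op q = .X := by
  induction S using Finset.strongInduction generalizing G with
  | H S ih =>
    by_cases hdone : ∀ k ∈ R, ∀ q ∈ S, (G k).op q = .I ∨ (G k).op q = .X
    · exact ⟨G, ColEquiv.refl _ _, hdone⟩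
    push Not at hdone
    obtain ⟨k, hk, s, hs, hks, -⟩ := hdone
    obtain ⟨G₁, e₁, h₁⟩ := exists_reduce_X hS G k hs hks
    -- Commuting with a row whose only entry in `S` is `X` forces `1` or `X` in column `s`. Such a
    -- column contributes nothing to the forms, so the hypothesis descends to `S.erase s`.
    have hcol : ∀ l ∈ R, (G₁ l).op s = .I ∨ (G₁ l).op s = .X := by
      intro l hl
      apply Pauli.eq_I_or_X
      rw [Pauli.anti_comm, ← form_eq_of_single hs h₁, e₁.form, hR k hk l hl]
    obtain ⟨G₂, e₂, h₂⟩ := ih (S.erase s) (Finset.erase_ssubset hs)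
      (fun q hq r hr => hS q (Finset.mem_of_mem_erase hq) r (Finset.mem_of_mem_erase hr)) G₁ (by
        intro l hl m hm
        have h := hR l hl m hm
        rw [← e₁.form] at h
        unfold StabOp.form at h ⊢
        rw [← Finset.add_sum_erase _ _ hs] at h
        have h0 : ((G₁ l).op s).anti ((G₁ m).op s) = 0 := by
          rcases hcol l hl with h | h <;> rcases hcol m hm with h' | h' <;> rw [h, h'] <;> rfl
        rwa [h0, zero_add] at h)
    refine ⟨G₂, e₁.trans (e₂.mono (Finset.erase_subset _ _)), fun l hl q hq => ?_⟩
    by_cases hqs : q = s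
    · subst hqs
      rw [e₂.op_eq l q (by simp)]
      exact hcol l hl
    · exact h₂ l hl q (Finset.mem_erase.2 ⟨hqs, hq⟩)

end StabArray

/-! ## Reduction to normal form -/

lemma Qubit.ext_pos {NA NB : ℕ} {q r : Qubit NA NB} (h : q.SameParty r) (h' : q.pos = r.pos) :
    q = r := by
  rcases q with i | i <;> rcases r with j | j <;>
    simp_all [Qubit.SameParty, Qubit.pos, Fin.ext_iff]

namespace StabArray

variable {NA NB K : ℕ}

/-- The columns from `p` on of one of the parties (A for `true`). -/
def columns (NA NB : ℕ) (b : Bool) (p : ℕ) : Finset (Qubit NA NB) :=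
  Finset.univ.filter fun q => q.isLeft = b ∧ p ≤ q.pos

lemma mem_columns {b : Bool} {p : ℕ} {q : Qubit NA NB} :
    q ∈ columns NA NB b p ↔ q.isLeft = b ∧ p ≤ q.pos := by simp [columns]

lemma sameParty_columns {b : Bool} {p : ℕ} :
    ∀ q ∈ columns NA NB b p, ∀ r ∈ columns NA NB b p, q.SameParty r := by
  intro q hq r hr
  exact (mem_columns.1 hq).1.trans (mem_columns.1 hr).1.symm

/-- An array whose first `2 * p` rows and first `p` columns at A and B are in normal form. -/
structure PartialForm (p : ℕ) (G : StabArray NA NB K) : Prop where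
  two_mul_le : 2 * p ≤ K
  le_A : p ≤ NA
  le_B : p ≤ NB
  pair_rows : ∀ (k : Fin K) (q : Qubit NA NB), (k : ℕ) < 2 * p →
    (G k).op q = if q.pos = (k : ℕ) / 2 then (if (k : ℕ) % 2 = 0 then .X else .Z) else .I
  phase : ∀ k : Fin K, (k : ℕ) < 2 * p → (G k).phase = 0
  lower_left : ∀ (k : Fin K) (q : Qubit NA NB), 2 * p ≤ (k : ℕ) → q.pos < p → (G k).op q = .I

namespace PartialForm

variable {p : ℕ} {G G' : StabArray NA NB K}

lemma zero (G : StabArray NA NB K) : PartialForm 0 G :=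
  ⟨by simp, by simp, by simp, by simp, by simp, by simp⟩

lemma of_rows (h : PartialForm p G) (hu : ∀ k : Fin K, (k : ℕ) < 2 * p → G' k = G k)
    (hl : ∀ (k : Fin K) (q : Qubit NA NB), 2 * p ≤ (k : ℕ) → q.pos < p → (G' k).op q = .I) :
    PartialForm p G' where
  two_mul_le := h.two_mul_le
  le_A := h.le_A
  le_B := h.le_B
  pair_rows k q hk := by rw [hu k hk]; exact h.pair_rows k q hk
  phase k hk := by rw [hu k hk]; exact h.phase k hk
  lower_left := hl

/-- The finished pair rows are trivial in the columns from `p` on, so the operations do not touch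
them, not even their phases; the first `p` columns are outside the column set. -/
lemma colEquiv (h : PartialForm p G) {b : Bool} (e : ColEquiv (columns NA NB b p) G G') :
    PartialForm p G' := by
  refine h.of_rows (fun k hk => e.eq_of_trivial k fun q hq => ?_) fun k q hk hq => ?_
  · rw [h.pair_rows k q hk, if_neg]
    have := (mem_columns.1 hq).2
    omega
  · rw [e.op_eq k q, h.lower_left k q hk hq]
    rw [mem_columns]
    omega

lemma rowSwap (h : PartialForm p G) {k l : Fin K} (hk : 2 * p ≤ (k : ℕ)) (hl : 2 * p ≤ (l : ℕ)) :
    PartialForm p (G ∘ Equiv.swap k l) := by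
  refine h.of_rows (fun m hm => ?_) fun m q hm hq => ?_
  · have h1 : m ≠ k := by rintro rfl; omega
    have h2 : m ≠ l := by rintro rfl; omega
    simp [Equiv.swap_apply_of_ne_of_ne h1 h2]
  · refine h.lower_left _ q ?_ hq
    by_cases h1 : m = k
    · simpa [h1] using hl
    · by_cases h2 : m = l
      · simpa [h2] using hk
      · rwa [Equiv.swap_apply_of_ne_of_ne h1 h2]

lemma rowMul (h : PartialForm p G) {k l : Fin K} (hk : 2 * p ≤ (k : ℕ)) (hl : 2 * p ≤ (l : ℕ)) :
    PartialForm p (Function.update G l ((G k).mul (G l))) := by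
  refine h.of_rows (fun m hm => ?_) fun m q hm hq => ?_
  · have h2 : m ≠ l := by rintro rfl; omega
    simp [h2]
  · by_cases h2 : m = l
    · subst h2
      simp [StabOp.mul, h.lower_left k q hk hq, h.lower_left m q hl hq, Pauli.mul]
    · simp [h2, h.lower_left m q hm hq]

/-- The first `p` columns of row `k` are trivial. For commuting rows the two summands therefore
coincide, which couples the parties. -/
lemma form_eq (h : PartialForm p G) {k l : Fin K} (hk : 2 * p ≤ (k : ℕ)) :
    StabOp.form Finset.univ (G k) (G l) = StabOp.form (columns NA NB true p) (G k) (G l) +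
      StabOp.form (columns NA NB false p) (G k) (G l) := by
  have hd : Disjoint (columns NA NB true p) (columns NA NB false p) := by
    rw [Finset.disjoint_left]
    intro q hq hq'
    rw [mem_columns] at hq hq'
    rw [hq.1] at hq'
    exact absurd hq'.1 (by decide)
  unfold StabOp.form
  rw [← Finset.sum_union hd]
  refine (Finset.sum_subset (Finset.subset_univ _) fun q _ hq => ?_).symm
  have hqp : q.pos < p := by
    simp only [Finset.mem_union, mem_columns, not_or] at hq
    cases hb : q.isLeft <;> rw [hb] at hq <;> simp at hq <;> exact hq
  rw [h.lower_left k q hk hqp, Pauli.anti_I_left]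

end PartialForm

/-- By Pauli operators on a qubit the phases of two rows can be made `+1`. -/
lemma exists_phase_zero {S : Finset (Qubit NA NB)} (G : StabArray NA NB K) (k l : Fin K)
    {s : Qubit NA NB} (hs : s ∈ S) (hk : (G k).op s = .X) (hl : (G l).op s = .Z)
    (hk' : Pauli.parity (G k).phase = 0) (hl' : Pauli.parity (G l).phase = 0) :
    ∃ G', ColEquiv S G G' ∧ (G' k).phase = 0 ∧ (G' l).phase = 0 ∧
      (G' k).op = (G k).op ∧ (G' l).op = (G l).op := by
  let F : QubitGate → StabArray NA NB K → StabArray NA NB K := fun u G k => (G k).applyGate u s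
  have hF : ∀ u G, ColEquiv S G (F u G) := fun u G => ColEquiv.gate G u hs
  -- On `X` and `Z` the three gates together act as conjugation by the Pauli operator `X`.
  have flipZ : ∀ G : StabArray NA NB K, ∃ G', ColEquiv S G G' ∧ ∀ m,
      ((G m).op s = .X → (G' m).op = (G m).op ∧ (G' m).phase = (G m).phase) ∧
      ((G m).op s = .Z → (G' m).op = (G m).op ∧ (G' m).phase = (G m).phase + 2) := by
    intro G
    refine ⟨F .HPPHPd (F .PHPd (F .PH G)), ((hF _ _).trans (hF _ _)).trans (hF _ _), fun m => ?_⟩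
    constructor <;> intro h <;>
      refine ⟨funext fun q => ?_, by simp [F, StabOp.applyGate, h, QubitGate.act]⟩ <;>
      by_cases hq : q = s <;> simp [F, StabOp.applyGate, hq, h, QubitGate.act]
  -- Similarly for conjugation by `Y`. It is used first, to repair row `k`; `flipZ` then repairs row
  -- `l` without disturbing row `k`.
  have flipXZ : ∀ G : StabArray NA NB K, ∃ G', ColEquiv S G G' ∧ ∀ m,
      ((G m).op s = .X → (G' m).op = (G m).op ∧ (G' m).phase = (G m).phase + 2) ∧
      ((G m).op s = .Z → (G' m).op = (G m).op ∧ (G' m).phase = (G m).phase + 2) := by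
    intro G
    refine ⟨F .PHPd (F .H (F .PH G)), ((hF _ _).trans (hF _ _)).trans (hF _ _), fun m => ?_⟩
    constructor <;> intro h <;>
      refine ⟨funext fun q => ?_, by simp [F, StabOp.applyGate, h, QubitGate.act]⟩ <;>
      by_cases hq : q = s <;> simp [F, StabOp.applyGate, hq, h, QubitGate.act]
  have h22 : (2 : ZMod 4) + 2 = 0 := by decide
  obtain ⟨G₁, e₁, h₁, h₁', h₁k, h₁l⟩ : ∃ G₁, ColEquiv S G G₁ ∧ (G₁ k).phase = 0 ∧
      Pauli.parity (G₁ l).phase = 0 ∧ (G₁ k).op = (G k).op ∧ (G₁ l).op = (G l).op := by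
    rcases (Pauli.parity_eq_zero_iff _).1 hk' with h | h
    · exact ⟨G, ColEquiv.refl _ _, h, hl', rfl, rfl⟩
    · obtain ⟨G₁, e₁, h₁⟩ := flipXZ G
      obtain ⟨a, b⟩ := (h₁ k).1 hk
      obtain ⟨a', b'⟩ := (h₁ l).2 hl
      refine ⟨G₁, e₁, by rw [b, h, h22], ?_, a, a'⟩
      rw [b', map_add, hl']; rfl
  rcases (Pauli.parity_eq_zero_iff _).1 h₁' with h | h
  · exact ⟨G₁, e₁, h₁, h, h₁k, h₁l⟩
  · obtain ⟨G₂, e₂, h₂⟩ := flipZ G₁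
    obtain ⟨a, b⟩ := (h₂ k).1 (by rw [h₁k, hk])
    obtain ⟨a', b'⟩ := (h₂ l).2 (by rw [h₁l, hl])
    exact ⟨G₂, e₁.trans e₂, by rw [b, h₁], by rw [b', h, h22], a.trans h₁k, a'.trans h₁l⟩

/-- With a pair of rows `X`, `Z` in column `s`, other rows can be made trivial in this column. -/
lemma exists_clear_column {p : ℕ} (G : StabArray NA NB K) (hG : PartialForm p G) (k l : Fin K)
    {s : Qubit NA NB} (hkp : 2 * p ≤ (k : ℕ)) (hlp : 2 * p ≤ (l : ℕ)) (hkX : (G k).op s = .X)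
    (hlZ : (G l).op s = .Z) (T : Finset (Fin K)) (hk : k ∉ T) (hl : l ∉ T)
    (hT : ∀ m ∈ T, 2 * p ≤ (m : ℕ)) :
    ∃ G', G.Reaches G' ∧ PartialForm p G' ∧ G' k = G k ∧ G' l = G l ∧
      ∀ m ∈ T, (G' m).op s = .I := by
  induction T using Finset.induction_on with
  | empty => exact ⟨G, .refl, hG, rfl, rfl, by simp⟩
  | insert m T hm ih =>
    simp only [Finset.mem_insert, not_or] at hk hl
    obtain ⟨G', r, h, h1, h2, h3⟩ := ih hk.2 hl.2 fun m hm => hT m (Finset.mem_insert_of_mem hm)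
    have hmp := hT m (Finset.mem_insert_self m T)
    have mulRow : ∀ G' : StabArray NA NB K, G.Reaches G' → PartialForm p G' → G' k = G k →
        G' l = G l → (∀ m ∈ T, (G' m).op s = .I) → ∀ j, j = k ∨ j = l →
        ∃ G'', G.Reaches G'' ∧ PartialForm p G'' ∧ G'' k = G k ∧ G'' l = G l ∧
          (∀ m ∈ T, (G'' m).op s = .I) ∧
          (G'' m).op s = (Pauli.mul ((G j).op s) ((G' m).op s)).2 := by
      intro G' r h h1 h2 h3 j hj
      have hjm : j ≠ m := by rcases hj with rfl | rfl <;> tauto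
      have hjp : 2 * p ≤ (j : ℕ) := by rcases hj with rfl | rfl <;> assumption
      have hjG : G' j = G j := by rcases hj with rfl | rfl <;> assumption
      refine ⟨_, r.tail (.rowMul G' j m hjm), h.rowMul hjp hmp, ?_, ?_, fun n hn => ?_, ?_⟩
      · simp [hk.1, h1]
      · simp [hl.1, h2]
      · have : n ≠ m := by rintro rfl; exact hm hn
        simp [this, h3 n hn]
      · simp [StabOp.mul, hjG]
    have fin : ∀ G' : StabArray NA NB K, G.Reaches G' → PartialForm p G' → G' k = G k →
        G' l = G l → (∀ m ∈ T, (G' m).op s = .I) → (G' m).op s = .I →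
        ∃ G'', G.Reaches G'' ∧ PartialForm p G'' ∧ G'' k = G k ∧ G'' l = G l ∧
          ∀ n ∈ insert m T, (G'' n).op s = .I := by
      intro G' r h h1 h2 h3 h4
      exact ⟨G', r, h, h1, h2, by simpa [h4] using h3⟩
    cases hms : (G' m).op s with
    | I => exact fin G' r h h1 h2 h3 hms
    | X =>
      obtain ⟨G'', a1, a2, a3, a4, a5, a6⟩ := mulRow G' r h h1 h2 h3 k (.inl rfl)
      exact fin G'' a1 a2 a3 a4 a5 (by rw [a6, hkX, hms]; rfl)
    | Z =>
      obtain ⟨G'', a1, a2, a3, a4, a5, a6⟩ := mulRow G' r h h1 h2 h3 l (.inr rfl)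
      exact fin G'' a1 a2 a3 a4 a5 (by rw [a6, hlZ, hms]; rfl)
    | Y =>
      obtain ⟨G'', a1, a2, a3, a4, a5, a6⟩ := mulRow G' r h h1 h2 h3 k (.inl rfl)
      obtain ⟨G₃, b1, b2, b3, b4, b5, b6⟩ := mulRow G'' a1 a2 a3 a4 a5 l (.inr rfl)
      exact fin G₃ b1 b2 b3 b4 b5 (by rw [b6, a6, hlZ, hkX, hms]; rfl)

/-- Two lower rows that anticommute at A give one more pair. -/
lemma PartialForm.exists_succ {p : ℕ} {G : StabArray NA NB K} (hG : PartialForm p G)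
    (hc : G.IsCommuting) {k l : Fin K} (hk : 2 * p ≤ (k : ℕ)) (hl : 2 * p ≤ (l : ℕ))
    (hkl : StabOp.form (columns NA NB true p) (G k) (G l) = 1) :
    ∃ G', G.Reaches G' ∧ PartialForm (p + 1) G' := by
  have hne : k ≠ l := by
    rintro rfl
    rw [StabOp.form_self] at hkl
    exact absurd hkl (by decide)
  have hne' : (k : ℕ) ≠ l := fun h => hne (Fin.ext h)
  -- The rows commute as a whole, so anticommutation at A must be compensated at B.
  have hkl' : StabOp.form (columns NA NB false p) (G k) (G l) = 1 := by
    have := hG.form_eq (l := l) hk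
    rw [hc.form, hkl] at this
    revert this
    generalize StabOp.form (columns NA NB false p) (G k) (G l) = x
    revert x; decide
  have nonempty : ∀ b, StabOp.form (columns NA NB b p) (G k) (G l) = 1 →
      ∃ s : Qubit NA NB, s.isLeft = b ∧ p ≤ s.pos := by
    intro b hb
    have hne : (columns NA NB b p).Nonempty := by
      rw [Finset.nonempty_iff_ne_empty]
      intro h0
      rw [h0] at hb
      simp [StabOp.form] at hb
    obtain ⟨s, hs⟩ := hne
    exact ⟨s, mem_columns.1 hs⟩
  have hpA : p < NA := by
    obtain ⟨s | s, h1, h2⟩ := nonempty true hkl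
    · exact lt_of_le_of_lt h2 s.2
    · simp at h1
  have hpB : p < NB := by
    obtain ⟨s | s, h1, h2⟩ := nonempty false hkl'
    · simp at h1
    · exact lt_of_le_of_lt h2 s.2
  have hK : 2 * p + 1 < K := by omega
  let a : Fin K := ⟨2 * p, by omega⟩
  let b : Fin K := ⟨2 * p + 1, hK⟩
  have hab : a ≠ b := by simp [a, b]
  have ha : 2 * p ≤ (a : ℕ) := le_rfl
  have hb : 2 * p ≤ (b : ℕ) := Nat.le_succ _
  -- move the two rows to their place
  obtain ⟨G₁, r₁, f₁, hA₁, hB₁⟩ : ∃ G₁, G.Reaches G₁ ∧ PartialForm p G₁ ∧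
      StabOp.form (columns NA NB true p) (G₁ a) (G₁ b) = 1 ∧
      StabOp.form (columns NA NB false p) (G₁ a) (G₁ b) = 1 := by
    -- The place of the second row after the first exchange, which has moved it if `l = a`.
    let l₁ := Equiv.swap k a l
    have hl₁ : 2 * p ≤ (l₁ : ℕ) := by
      by_cases h : l = a
      · simpa [l₁, h] using hk
      · simpa [l₁, Equiv.swap_apply_of_ne_of_ne hne.symm h] using hl
    have hl₁a : l₁ ≠ a := by
      intro h
      have : l = k := (Equiv.swap k a).injective (by rw [Equiv.swap_apply_left]; exact h)
      exact hne this.symm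
    have e1 : ((G ∘ Equiv.swap k a) ∘ Equiv.swap l₁ b) a = G k := by
      simp [Equiv.swap_apply_of_ne_of_ne hl₁a.symm hab]
    have e2 : ((G ∘ Equiv.swap k a) ∘ Equiv.swap l₁ b) b = G l := by
      simp [l₁]
    refine ⟨(G ∘ Equiv.swap k a) ∘ Equiv.swap l₁ b,
      (Relation.ReflTransGen.single (.rowSwap G k a)).tail (.rowSwap _ l₁ b),
      (hG.rowSwap hk ha).rowSwap hl₁ hb, ?_, ?_⟩
    · rw [e1, e2, hkl]
    · rw [e1, e2, hkl']
  let sA : Qubit NA NB := .inl ⟨p, hpA⟩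
  let sB : Qubit NA NB := .inr ⟨p, hpB⟩
  have hsA : sA ∈ columns NA NB true p := mem_columns.2 ⟨rfl, le_rfl⟩
  have hsB : sB ∈ columns NA NB false p := mem_columns.2 ⟨rfl, le_rfl⟩
  obtain ⟨G₂, e₂, h₂a, h₂b⟩ := exists_reduce_pair sameParty_columns G₁ a b hsA hA₁
  have hnot : ∀ (c : Bool) (q : Qubit NA NB), q ∈ columns NA NB c p →
      q ∉ columns NA NB (!c) p := by
    intro c q hq hq'
    have h1 := (mem_columns.1 hq).1
    have h2 := (mem_columns.1 hq').1
    rw [h1] at h2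
    cases c <;> simp at h2
  have hB₂ : StabOp.form (columns NA NB false p) (G₂ a) (G₂ b) = 1 := by
    rw [← hB₁]
    exact StabOp.form_congr (fun q hq => e₂.op_eq _ _ (hnot false q hq))
      (fun q hq => e₂.op_eq _ _ (hnot false q hq))
  obtain ⟨G₃, e₃, h₃a, h₃b⟩ := exists_reduce_pair sameParty_columns G₂ a b hsB hB₂
  have f₃ : PartialForm p G₃ := (f₁.colEquiv e₂).colEquiv e₃
  have r₃ : G.Reaches G₃ := Relation.ReflTransGen.trans
    (Relation.ReflTransGen.trans r₁ e₂.reaches) e₃.reaches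
  have c₃ := hc.reaches r₃
  -- The reduction at B leaves the columns of A alone, so the result at A can be taken from `G₂`.
  have full : ∀ (m : Fin K) (P : Pauli), 2 * p ≤ (m : ℕ) →
      (∀ q ∈ columns NA NB true p, (G₂ m).op q = if q = sA then P else .I) →
      (∀ q ∈ columns NA NB false p, (G₃ m).op q = if q = sB then P else .I) →
      ∀ q, (G₃ m).op q = if q.pos = p then P else .I := by
    intro m P hm h1 h2 q
    by_cases hq : q.pos < p
    · rw [f₃.lower_left m q hm hq, if_neg hq.ne]
    push Not at hq
    cases hql : q.isLeft with
    | true =>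
      have hqm : q ∈ columns NA NB true p := mem_columns.2 ⟨hql, hq⟩
      rw [e₃.op_eq m q (hnot true q hqm), h1 q hqm]
      congr 1
      refine propext ⟨fun h => by rw [h]; rfl, fun h => Qubit.ext_pos hql h⟩
    | false =>
      have hqm : q ∈ columns NA NB false p := mem_columns.2 ⟨hql, hq⟩
      rw [h2 q hqm]
      congr 1
      refine propext ⟨fun h => by rw [h]; rfl, fun h => Qubit.ext_pos hql h⟩
  have full_a := full a .X ha h₂a h₃a
  have full_b := full b .Z hb h₂b h₃b
  obtain ⟨G₄, e₄, p₄a, p₄b, o₄a, o₄b⟩ := exists_phase_zero G₃ a b hsA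
    (by rw [full_a]; exact if_pos rfl) (by rw [full_b]; exact if_pos rfl) (c₃.parity a)
    (c₃.parity b)
  have f₄ := f₃.colEquiv e₄
  have r₄ : G.Reaches G₄ := Relation.ReflTransGen.trans r₃ e₄.reaches
  obtain ⟨G₅, r₅, f₅, h₅a, h₅b, h₅⟩ := exists_clear_column G₄ f₄ a b (s := sA) ha hb
    (by rw [o₄a, full_a]; exact if_pos rfl) (by rw [o₄b, full_b]; exact if_pos rfl)
    (Finset.univ.filter fun m : Fin K => 2 * p + 2 ≤ (m : ℕ)) (by simp [a]) (by simp [b])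
    (by intro m hm; simp at hm; omega)
  have r₅' : G.Reaches G₅ := Relation.ReflTransGen.trans r₄ r₅
  have c₅ := hc.reaches r₅'
  have hpos : ∀ q : Qubit NA NB, q.pos = p → q = sA ∨ q = sB := by
    rintro (q | q) hq
    · exact .inl (Qubit.ext_pos rfl hq)
    · exact .inr (Qubit.ext_pos rfl hq)
  have hsAB : sA ≠ sB := by simp [sA, sB]
  refine ⟨G₅, r₅', ?_, hpA, hpB, ?_, ?_, ?_⟩
  · omega
  · intro m q hm
    by_cases hm' : (m : ℕ) < 2 * p
    · exact f₅.pair_rows m q hm'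
    · obtain h | h : (m : ℕ) = 2 * p ∨ (m : ℕ) = 2 * p + 1 := by omega
      · have : m = a := Fin.ext h
        subst this
        rw [h₅a, o₄a, full_a]
        simp [a]
      · have : m = b := Fin.ext h
        subst this
        have : (2 * p + 1) / 2 = p := by omega
        rw [h₅b, o₄b, full_b]
        simp [b, this, Nat.add_mod]
  · intro m hm
    by_cases hm' : (m : ℕ) < 2 * p
    · exact f₅.phase m hm'
    · obtain h | h : (m : ℕ) = 2 * p ∨ (m : ℕ) = 2 * p + 1 := by omega
      · have : m = a := Fin.ext h
        subst this
        rw [h₅a, p₄a]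
      · have : m = b := Fin.ext h
        subst this
        rw [h₅b, p₄b]
  · intro m q hm hq
    have hA : (G₅ m).op sA = .I := h₅ m (by simp; omega)
    -- Only the column at A has been cleared actively. Row `m` commutes with the new pair, which
    -- lives on `sA` and `sB` alone, so its entry at `sB` commutes with both `X` and `Z` and is
    -- trivial.
    have key : ∀ (n : Fin K) (P : Pauli), (∀ q, (G₅ n).op q = if q.pos = p then P else .I) →
        ((G₅ m).op sB).anti P = 0 := by
      intro n P hn
      have := c₅.form n m
      unfold StabOp.form at this
      rw [← Finset.sum_subset (Finset.subset_univ {sA, sB}), Finset.sum_pair hsAB, hA,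
        Pauli.anti_I_right, zero_add, hn, if_pos (by rfl), Pauli.anti_comm] at this
      · exact this
      · intro q _ hq
        have : q.pos ≠ p := fun h => hq (by simpa using hpos q h)
        rw [hn, if_neg this, Pauli.anti_I_left]
    have hB : (G₅ m).op sB = .I := Pauli.eq_I_of_anti
      (key a .X (by rw [h₅a, o₄a]; exact full_a)) (key b .Z (by rw [h₅b, o₄b]; exact full_b))
    by_cases hq' : q.pos < p
    · exact f₅.lower_left m q (by omega) hq'
    · rcases hpos q (by omega) with rfl | rfl <;> assumption

/-- Every array with commuting rows can be brought to normal form. -/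
theorem IsCommuting.exists_normalForm {G : StabArray NA NB K} (hc : G.IsCommuting) :
    ∃ (p : ℕ) (G' : StabArray NA NB K), G.Reaches G' ∧ G'.NormalForm p ∧
      ∀ k : Fin K, (k : ℕ) < 2 * p → (G' k).phase = 0 := by
  have main : ∀ (n p : ℕ) (G₁ : StabArray NA NB K), NA - p = n → G.Reaches G₁ →
      PartialForm p G₁ → ∃ (p : ℕ) (G' : StabArray NA NB K), G.Reaches G' ∧ G'.NormalForm p ∧
      ∀ k : Fin K, (k : ℕ) < 2 * p → (G' k).phase = 0 := by
    intro n
    induction n using Nat.strong_induction_on with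
    | h n ih =>
    intro p G₁ hn r₁ f₁
    have c₁ := hc.reaches r₁
    by_cases hex : ∃ k l : Fin K, 2 * p ≤ (k : ℕ) ∧ 2 * p ≤ (l : ℕ) ∧
        StabOp.form (columns NA NB true p) (G₁ k) (G₁ l) = 1
    · obtain ⟨k, l, hk, hl, hkl⟩ := hex
      obtain ⟨G₂, r₂, f₂⟩ := f₁.exists_succ c₁ hk hl hkl
      have := f₂.le_A
      exact ih (NA - (p + 1)) (by omega) (p + 1) G₂ rfl (Relation.ReflTransGen.trans r₁ r₂) f₂
    · push Not at hex
      have hA : ∀ k ∈ {k : Fin K | 2 * p ≤ (k : ℕ)}, ∀ l ∈ {k : Fin K | 2 * p ≤ (k : ℕ)},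
          StabOp.form (columns NA NB true p) (G₁ k) (G₁ l) = 0 := by
        intro k hk l hl
        have := hex k l hk hl
        revert this
        generalize StabOp.form (columns NA NB true p) (G₁ k) (G₁ l) = x
        revert x; decide
      obtain ⟨G₂, e₂, h₂⟩ := exists_reduce_commuting sameParty_columns _ G₁ hA
      have f₂ := f₁.colEquiv e₂
      have r₂ := Relation.ReflTransGen.trans r₁ e₂.reaches
      have c₂ := hc.reaches r₂
      -- The total form vanishes, and the form at A vanished before and is preserved by `e₂`.
      have hB : ∀ k ∈ {k : Fin K | 2 * p ≤ (k : ℕ)}, ∀ l ∈ {k : Fin K | 2 * p ≤ (k : ℕ)},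
          StabOp.form (columns NA NB false p) (G₂ k) (G₂ l) = 0 := by
        intro k hk l hl
        have := f₂.form_eq (l := l) hk
        rwa [c₂.form, e₂.form, hA k hk l hl, zero_add, eq_comm] at this
      obtain ⟨G₃, e₃, h₃⟩ := exists_reduce_commuting sameParty_columns _ G₂ hB
      have f₃ := f₂.colEquiv e₃
      refine ⟨p, G₃, Relation.ReflTransGen.trans r₂ e₃.reaches,
        ⟨f₃.two_mul_le, f₃.le_A, f₃.le_B, f₃.pair_rows, f₃.lower_left, ?_⟩, f₃.phase⟩
      intro k q hk hq
      cases hb : q.isLeft with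
      | true =>
        rw [e₃.op_eq k q (by rw [mem_columns, hb]; simp)]
        exact h₂ k hk q (mem_columns.2 ⟨hb, hq⟩)
      | false => exact h₃ k hk q (mem_columns.2 ⟨hb, hq⟩)
  exact main _ 0 G rfl .refl (PartialForm.zero G)

end StabArray

/-! ## Tensor products over finite families -/

/-- The tensor product of a finite family of matrices. -/
def piKron {ι α β : Type*} [Fintype ι] (M : ι → Matrix α β ℂ) : Matrix (ι → α) (ι → β) ℂ :=
  Matrix.of fun x y => ∏ i, M i (x i) (y i)

section piKron

variable {ι α β γ : Type*} [Fintype ι]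

lemma piKron_mul [Fintype β] (M : ι → Matrix α β ℂ) (N : ι → Matrix β γ ℂ) [Fintype (ι → β)] :
    piKron M * piKron N = piKron fun i => M i * N i := by
  classical
  ext x y
  simp only [piKron, Matrix.mul_apply, Matrix.of_apply]
  rw [Finset.prod_univ_sum, Fintype.piFinset_univ]
  refine Finset.sum_congr (by ext; simp) fun z _ => Finset.prod_mul_distrib.symm

lemma piKron_one [DecidableEq α] [DecidableEq (ι → α)] :
    piKron (fun _ : ι => (1 : Matrix α α ℂ)) = 1 := by
  ext x y
  simp only [piKron, Matrix.of_apply, Matrix.one_apply]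
  by_cases h : x = y
  · simp [h]
  · obtain ⟨i, hi⟩ := Function.ne_iff.1 h
    rw [if_neg h]
    exact Finset.prod_eq_zero (Finset.mem_univ i) (if_neg hi)

lemma piKron_conjTranspose (M : ι → Matrix α β ℂ) : (piKron M)ᴴ = piKron fun i => (M i)ᴴ := by
  ext x y
  simp [piKron, Matrix.conjTranspose_apply]

lemma piKron_unitary [Fintype α] [DecidableEq β] [Fintype (ι → α)] [DecidableEq (ι → β)]
    {M : ι → Matrix α β ℂ} (hM : ∀ i, (M i)ᴴ * M i = 1) : (piKron M)ᴴ * piKron M = 1 := by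
  rw [piKron_conjTranspose, piKron_mul]
  simp [hM, piKron_one]

lemma piKron_unitary' [Fintype β] [DecidableEq α] [Fintype (ι → β)] [DecidableEq (ι → α)]
    {M : ι → Matrix α β ℂ} (hM : ∀ i, M i * (M i)ᴴ = 1) : piKron M * (piKron M)ᴴ = 1 := by
  rw [piKron_conjTranspose, piKron_mul]
  simp [hM, piKron_one]

end piKron

/-- A tensor product of one-qubit operators, as an operator on the bipartite system. -/
def qubitTensor {NA NB : ℕ} (M : Qubit NA NB → Matrix (Fin 2) (Fin 2) ℂ) :
    Matrix (Bits NA × Bits NB) (Bits NA × Bits NB) ℂ :=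
  piKron (fun i => M (.inl i)) ⊗ₖ piKron (fun j => M (.inr j))

section qubitTensor

variable {NA NB : ℕ} (M N : Qubit NA NB → Matrix (Fin 2) (Fin 2) ℂ)

lemma qubitTensor_apply (x y : Bits NA × Bits NB) :
    qubitTensor M x y = ∏ q, M q (Sum.elim x.1 x.2 q) (Sum.elim y.1 y.2 q) := by
  simp [qubitTensor, piKron]

lemma qubitTensor_mul : qubitTensor M * qubitTensor N = qubitTensor fun q => M q * N q := by
  simp only [qubitTensor, ← Matrix.mul_kronecker_mul, piKron_mul]

lemma qubitTensor_one : qubitTensor (fun _ : Qubit NA NB => 1) = 1 := by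
  simp only [qubitTensor, piKron_one, Matrix.one_kronecker_one]

lemma qubitTensor_conjTranspose : (qubitTensor M)ᴴ = qubitTensor fun q => (M q)ᴴ := by
  simp only [qubitTensor, Matrix.conjTranspose_kronecker, piKron_conjTranspose]

lemma qubitTensor_smul (c : Qubit NA NB → ℂ) :
    (qubitTensor fun q => c q • M q) = (∏ q, c q) • qubitTensor M := by
  ext x y
  simp [qubitTensor_apply, Finset.prod_mul_distrib]

end qubitTensor

/-! ## Powers of `i` and signs -/

/-- The power of `i` with an exponent modulo 4. -/
def iPow (m : ZMod 4) : ℂ := Complex.I ^ m.val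

lemma iPow_zero : iPow 0 = 1 := by simp [iPow]

lemma iPow_two : iPow 2 = -1 := by
  have : (2 : ZMod 4).val = 2 := rfl
  simp [iPow, this]

lemma iPow_add (m n : ZMod 4) : iPow (m + n) = iPow m * iPow n := by
  rw [iPow, ZMod.val_add, ← Complex.I_pow_eq_pow_mod, pow_add]; rfl

lemma iPow_sum {ι : Type*} (s : Finset ι) (f : ι → ZMod 4) :
    iPow (∑ i ∈ s, f i) = ∏ i ∈ s, iPow (f i) := by
  classical
  induction s using Finset.induction_on with
  | empty => simp [iPow_zero]
  | insert a s ha ih => rw [Finset.sum_insert ha, Finset.prod_insert ha, iPow_add, ih]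

lemma star_iPow_mul (m : ZMod 4) : star (iPow m) * iPow m = 1 := by
  simp [iPow, ← mul_pow]

/-- The sign `(-1) ^ x`. -/
def signOf (x : ZMod 2) : ℂ := if x = 0 then 1 else -1

lemma signOf_add (x y : ZMod 2) : signOf (x + y) = signOf x * signOf y := by
  have : ∀ x : ZMod 2, x = 0 ∨ x = 1 := by decide
  have h : (1 : ZMod 2) + 1 = 0 := by decide
  rcases this x with rfl | rfl <;> rcases this y with rfl | rfl <;> simp [signOf, h]

lemma signOf_sum {ι : Type*} (s : Finset ι) (f : ι → ZMod 2) :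
    signOf (∑ i ∈ s, f i) = ∏ i ∈ s, signOf (f i) := by
  classical
  induction s using Finset.induction_on with
  | empty => simp [signOf]
  | insert a s ha ih => rw [Finset.sum_insert ha, Finset.prod_insert ha, signOf_add, ih]

/-! ## The matrices of stabiliser operators -/

namespace Pauli

lemma toMatrix_mul (a b : Pauli) :
    a.toMatrix * b.toMatrix = iPow (mul a b).1 • (mul a b).2.toMatrix := by
  have h3 : iPow 3 = -Complex.I := by
    have : (3 : ZMod 4).val = 3 := rfl
    simp [iPow, this, pow_succ]
  have h1 : iPow 1 = Complex.I := by
    have : (1 : ZMod 4).val = 1 := rfl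
    simp [iPow, this]
  cases a <;> cases b <;> simp [mul, toMatrix, iPow_zero, h1, h3, Matrix.one_fin_two]

lemma conjTranspose_toMatrix (a : Pauli) : a.toMatrixᴴ = a.toMatrix := by
  cases a <;> ext i j <;> fin_cases i <;> fin_cases j <;>
    simp [toMatrix, Matrix.conjTranspose_apply]

lemma toMatrix_sq (a : Pauli) : a.toMatrix * a.toMatrix = 1 := by
  cases a <;> simp [toMatrix, Matrix.one_fin_two]

lemma toMatrix_comm (a b : Pauli) :
    a.toMatrix * b.toMatrix = signOf (a.anti b) • (b.toMatrix * a.toMatrix) := by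
  cases a <;> cases b <;> simp [anti, toMatrix, signOf, Matrix.one_fin_two]

end Pauli

namespace StabOp

variable {NA NB : ℕ} (g h : StabOp NA NB)

lemma toMatrix_eq : g.toMatrix = iPow g.phase • qubitTensor fun q => (g.op q).toMatrix := by
  ext x y
  simp [toMatrix, qubitTensor_apply, iPow]

lemma toMatrix_mul : (g.mul h).toMatrix = g.toMatrix * h.toMatrix := by
  simp only [toMatrix_eq, mul, smul_mul_smul_comm, qubitTensor_mul, Pauli.toMatrix_mul,
    qubitTensor_smul, iPow_add, iPow_sum, smul_smul]

lemma toMatrix_comm : g.toMatrix * h.toMatrix =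
    signOf (form Finset.univ g h) • (h.toMatrix * g.toMatrix) := by
  simp only [toMatrix_eq, smul_mul_smul_comm, qubitTensor_mul]
  simp_rw [Pauli.toMatrix_comm (g.op _)]
  rw [qubitTensor_smul, smul_smul, smul_smul, form, signOf_sum]
  congr 1
  ring

lemma toMatrix_unitary : g.toMatrixᴴ * g.toMatrix = 1 := by
  rw [toMatrix_eq, Matrix.conjTranspose_smul, qubitTensor_conjTranspose, smul_mul_smul_comm,
    qubitTensor_mul, star_iPow_mul, one_smul]
  simp only [Pauli.conjTranspose_toMatrix, Pauli.toMatrix_sq, qubitTensor_one]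

/-- Two such operators commute or anticommute according to the form. They cannot do both, since
their product would vanish although they are unitary. -/
lemma commute_iff : Commute g.toMatrix h.toMatrix ↔ form Finset.univ g h = 0 := by
  constructor
  · intro hc
    by_contra h0
    have h1 := toMatrix_comm g h
    rw [signOf, if_neg h0, neg_one_smul, ← hc.eq, eq_neg_iff_add_eq_zero, ← two_smul ℂ,
      smul_eq_zero_iff_right two_ne_zero] at h1
    have h2 : (g.toMatrixᴴ * (g.toMatrix * h.toMatrix)) = 0 := by rw [h1, mul_zero]
    rw [← mul_assoc, toMatrix_unitary, one_mul] at h2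
    have h3 := toMatrix_unitary h
    rw [h2, mul_zero] at h3
    exact zero_ne_one h3
  · intro h0
    have h1 := toMatrix_comm g h
    rwa [h0, signOf, if_pos rfl, one_smul] at h1

lemma conjTranspose_toMatrix {g : StabOp NA NB} (hg : Pauli.parity g.phase = 0) :
    g.toMatrixᴴ = g.toMatrix := by
  rw [toMatrix_eq, Matrix.conjTranspose_smul, qubitTensor_conjTranspose]
  simp only [Pauli.conjTranspose_toMatrix]
  congr 1
  rcases (Pauli.parity_eq_zero_iff _).1 hg with h | h <;> simp [h, iPow_zero, iPow_two]

lemma toMatrix_sq {g : StabOp NA NB} (hg : Pauli.parity g.phase = 0) :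
    g.toMatrix * g.toMatrix = 1 := by
  have h := toMatrix_unitary g
  rwa [conjTranspose_toMatrix hg] at h

lemma toMatrix_conj {g h : StabOp NA NB} (M : Qubit NA NB → Matrix (Fin 2) (Fin 2) ℂ)
    (m : Qubit NA NB → ZMod 4)
    (hM : ∀ q, M q * (g.op q).toMatrix * (M q)ᴴ = iPow (m q) • (h.op q).toMatrix)
    (hm : h.phase = g.phase + ∑ q, m q) :
    h.toMatrix = qubitTensor M * g.toMatrix * (qubitTensor M)ᴴ := by
  rw [toMatrix_eq, toMatrix_eq, qubitTensor_conjTranspose, mul_smul_comm, smul_mul_assoc,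
    qubitTensor_mul, qubitTensor_mul]
  simp only [hM]
  rw [qubitTensor_smul, smul_smul, hm, iPow_add, iPow_sum]

end StabOp

/-! ### Unitaries of the single-qubit gates -/

namespace QubitGate

/-- The unitaries of the single-qubit column operations, up to phase. -/
noncomputable def toMatrix : QubitGate → Matrix (Fin 2) (Fin 2) ℂ
  | one => 1
  -- Global phases that are eighth roots of unity remove the square roots of 2, so that all entries
  -- are Gaussian rationals.
  | PH => (2⁻¹ : ℂ) • !![1 + Complex.I, 1 + Complex.I; Complex.I - 1, 1 - Complex.I]
  | HPd => (2⁻¹ : ℂ) • !![1 - Complex.I, -1 - Complex.I; 1 - Complex.I, 1 + Complex.I]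
  | PHPd => (2⁻¹ : ℂ) • !![1 + Complex.I, 1 - Complex.I; Complex.I - 1, -1 - Complex.I]
  | HPPHPd => !![0, 1; Complex.I, 0]
  | H => (2⁻¹ : ℂ) • !![1 + Complex.I, 1 + Complex.I; 1 + Complex.I, -1 - Complex.I]

lemma toMatrix_unitary (u : QubitGate) : u.toMatrixᴴ * u.toMatrix = 1 := by
  cases u <;> ext i j <;> fin_cases i <;> fin_cases j <;> apply Complex.ext <;>
    simp [toMatrix, Matrix.mul_apply, Matrix.conjTranspose_apply] <;> norm_num

lemma toMatrix_mul_pauli (u : QubitGate) (a : Pauli) :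
    u.toMatrix * a.toMatrix = iPow (u.act a).1 • ((u.act a).2.toMatrix * u.toMatrix) := by
  cases a
  · simp [Pauli.toMatrix, iPow_zero]
  all_goals
    cases u <;> simp only [toMatrix, act, Pauli.toMatrix, iPow_zero, iPow_two, one_mul, mul_one,
      one_smul, smul_mul_assoc, mul_smul_comm, neg_smul] <;> try rw [← smul_neg]
  all_goals
    try refine congrArg (fun M => (2⁻¹ : ℂ) • M) ?_
    ext i j; fin_cases i <;> fin_cases j <;>
      simp [sub_mul, mul_sub, add_mul, mul_add] <;> ring_nf

lemma toMatrix_conj (u : QubitGate) (a : Pauli) :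
    u.toMatrix * a.toMatrix * u.toMatrixᴴ = iPow (u.act a).1 • (u.act a).2.toMatrix := by
  rw [toMatrix_mul_pauli, smul_mul_assoc, mul_assoc, mul_eq_one_comm.1 u.toMatrix_unitary, mul_one]

end QubitGate

/-! ## Local equivalence -/

lemma kronecker_unitary {a b a' b' : Type*} [DecidableEq a] [DecidableEq b] [Fintype a']
    [Fintype b'] {U : Matrix a' a ℂ} {V : Matrix b' b ℂ} (hU : Uᴴ * U = 1) (hV : Vᴴ * V = 1) :
    (U ⊗ₖ V)ᴴ * (U ⊗ₖ V) = 1 := by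
  rw [Matrix.conjTranspose_kronecker, ← Matrix.mul_kronecker_mul, hU, hV, Matrix.one_kronecker_one]

lemma kronecker_unitary' {a b a' b' : Type*} [Fintype a] [Fintype b] [DecidableEq a']
    [DecidableEq b'] {U : Matrix a' a ℂ} {V : Matrix b' b ℂ} (hU : U * Uᴴ = 1) (hV : V * Vᴴ = 1) :
    (U ⊗ₖ V) * (U ⊗ₖ V)ᴴ = 1 := by
  rw [Matrix.conjTranspose_kronecker, ← Matrix.mul_kronecker_mul, hU, hV, Matrix.one_kronecker_one]

namespace LocallyEquivalent

variable {a b a' b' a'' b'' : Type} [Fintype a] [DecidableEq a] [Fintype b] [DecidableEq b]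
  [Fintype a'] [DecidableEq a'] [Fintype b'] [DecidableEq b']
  [Fintype a''] [DecidableEq a''] [Fintype b''] [DecidableEq b'']
  {ρ : Matrix (a × b) (a × b) ℂ} {σ : Matrix (a' × b') (a' × b') ℂ}
  {τ : Matrix (a'' × b'') (a'' × b'') ℂ}

lemma refl (ρ : Matrix (a × b) (a × b) ℂ) : LocallyEquivalent ρ ρ :=
  ⟨1, 1, by simp, by simp, by simp, by simp, by simp⟩

lemma symm (h : LocallyEquivalent ρ σ) : LocallyEquivalent σ ρ := by
  obtain ⟨U, V, h1, h2, h3, h4, rfl⟩ := h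
  refine ⟨Uᴴ, Vᴴ, by simpa using h2, by simpa using h1, by simpa using h4, by simpa using h3, ?_⟩
  rw [← Matrix.conjTranspose_kronecker, Matrix.conjTranspose_conjTranspose]
  have := kronecker_unitary h1 h3
  generalize U ⊗ₖ V = W at *
  rw [Matrix.mul_assoc, Matrix.mul_assoc (W * ρ), this, Matrix.mul_one, ← Matrix.mul_assoc, this,
    Matrix.one_mul]

lemma trans (h : LocallyEquivalent ρ σ) (h' : LocallyEquivalent σ τ) : LocallyEquivalent ρ τ := by
  obtain ⟨U, V, h1, h2, h3, h4, rfl⟩ := h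
  obtain ⟨U', V', h1', h2', h3', h4', rfl⟩ := h'
  refine ⟨U' * U, V' * V, ?_, ?_, ?_, ?_, ?_⟩
  · rw [Matrix.conjTranspose_mul, Matrix.mul_assoc, ← Matrix.mul_assoc U'ᴴ, h1', Matrix.one_mul, h1]
  · rw [Matrix.conjTranspose_mul, Matrix.mul_assoc, ← Matrix.mul_assoc U, h2, Matrix.one_mul, h2']
  · rw [Matrix.conjTranspose_mul, Matrix.mul_assoc, ← Matrix.mul_assoc V'ᴴ, h3', Matrix.one_mul, h3]
  · rw [Matrix.conjTranspose_mul, Matrix.mul_assoc, ← Matrix.mul_assoc V, h4, Matrix.one_mul, h4']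
  · rw [Matrix.mul_kronecker_mul, Matrix.conjTranspose_mul]
    simp only [Matrix.mul_assoc]

lemma trace_eq (h : LocallyEquivalent ρ σ) : σ.trace = ρ.trace := by
  obtain ⟨U, V, h1, h2, h3, h4, rfl⟩ := h
  rw [Matrix.trace_mul_comm, ← Matrix.mul_assoc, kronecker_unitary h1 h3, Matrix.one_mul]

lemma isDensity (h : LocallyEquivalent ρ σ) (hρ : IsDensity ρ) : IsDensity σ := by
  refine ⟨?_, by rw [h.trace_eq, hρ.2]⟩
  obtain ⟨U, V, -, -, -, -, rfl⟩ := h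
  exact hρ.1.mul_mul_conjTranspose_same _

end LocallyEquivalent

/-- The matrix of a relabelling of a basis. -/
def relabelMatrix {a a' : Type} [DecidableEq a] (e : a' ≃ a) : Matrix a' a ℂ :=
  (1 : Matrix a a ℂ).submatrix e id

section relabel

variable {a b a' b' : Type} [Fintype a] [DecidableEq a] [Fintype b] [DecidableEq b]

lemma relabelMatrix_unitary [Fintype a'] (e :
    a' ≃ a) : (relabelMatrix e)ᴴ * relabelMatrix e = 1 := by
  rw [relabelMatrix, Matrix.conjTranspose_submatrix, Matrix.submatrix_mul_equiv]
  simp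

lemma relabelMatrix_unitary' [DecidableEq a'] (e :
    a' ≃ a) : relabelMatrix e * (relabelMatrix e)ᴴ = 1 := by
  have : (relabelMatrix e * (relabelMatrix e)ᴴ) =
      ((1 : Matrix a a ℂ) * (1 : Matrix a a ℂ)).submatrix e e := by
    rw [relabelMatrix, Matrix.conjTranspose_submatrix, Matrix.conjTranspose_one]
    exact Matrix.submatrix_mul_equiv 1 1 e (Equiv.refl a) e
  rw [this, mul_one, Matrix.submatrix_one_equiv]

/-- Permutation matrices are unitary. CNOTs and column exchanges only permute the computational
basis, as does the regrouping of qubits, so all of them are covered by this. -/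
lemma submatrix_eq_conj (e : a' ≃ a) (f : b' ≃ b) (ρ : Matrix (a × b) (a × b) ℂ) :
    ρ.submatrix (Prod.map e f) (Prod.map e f) = (relabelMatrix e ⊗ₖ relabelMatrix f) * ρ *
      (relabelMatrix e ⊗ₖ relabelMatrix f)ᴴ := by
  have h : relabelMatrix e ⊗ₖ relabelMatrix f =
      (1 : Matrix (a × b) (a × b) ℂ).submatrix (e.prodCongr f) (Equiv.refl _) := by
    rw [← Matrix.one_kronecker_one]; rfl
  rw [h, Matrix.conjTranspose_submatrix, Matrix.conjTranspose_one]
  have h2 : ρ = ρ.submatrix (Equiv.refl _) (Equiv.refl _) := rfl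
  conv_rhs => rw [h2]
  rw [Matrix.submatrix_mul_equiv, Matrix.submatrix_mul_equiv, one_mul, mul_one]
  rfl

lemma locallyEquivalent_submatrix [Fintype a'] [DecidableEq a'] [Fintype b'] [DecidableEq b']
    (e : a' ≃ a) (f : b' ≃ b) (ρ : Matrix (a × b) (a × b) ℂ) :
    LocallyEquivalent ρ (ρ.submatrix (Prod.map e f) (Prod.map e f)) :=
  ⟨relabelMatrix e, relabelMatrix f, relabelMatrix_unitary e, relabelMatrix_unitary' e,
    relabelMatrix_unitary f, relabelMatrix_unitary' f, submatrix_eq_conj e f ρ⟩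

end relabel

/-! ### Commuting generators in a commutative algebra -/

open scoped IsMulCommutative in
/-- Commuting elements of an algebra are images of elements of a commutative ring. -/
lemma exists_commRing_lift {A : Type} [Ring A] [Algebra ℂ A] {n : ℕ} (f : Fin n → A)
    (hf : ∀ i j, Commute (f i) (f j)) :
    ∃ (R : Type) (_ : CommRing R) (_ : Algebra ℂ R) (φ : R →ₐ[ℂ] A) (f' : Fin n → R),
      Function.Injective φ ∧ ∀ i, φ (f' i) = f i := by
  have := Algebra.isMulCommutative_adjoin ℂ (s := Set.range f) (by
    rintro _ ⟨i, rfl⟩ _ ⟨j, rfl⟩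
    exact hf i j)
  exact ⟨Algebra.adjoin ℂ (Set.range f), inferInstance, inferInstance,
    (Algebra.adjoin ℂ (Set.range f)).val, fun i => ⟨f i, Algebra.subset_adjoin ⟨i, rfl⟩⟩,
    Subtype.val_injective, fun _ => rfl⟩

lemma map_prod_ofFn {R A : Type} [CommRing R] [Algebra ℂ R] [Ring A] [Algebra ℂ A]
    (φ : R →ₐ[ℂ] A) {n : ℕ} (f : Fin n → R) :
    (List.ofFn fun i => φ (f i)).prod = φ (∏ i, f i) := by
  rw [← List.prod_ofFn, map_list_prod, List.map_ofFn]
  rfl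

/-! ### Invariance of the state under elementary operations -/

namespace StabArray

variable {NA NB K : ℕ}

lemma IsCommuting.commute {G : StabArray NA NB K} (hG : G.IsCommuting) (k l : Fin K) :
    Commute (G k).toMatrix (G l).toMatrix := (StabOp.commute_iff _ _).2 (hG.form k l)

lemma IsGeneratorSet.isCommuting {G : StabArray NA NB K} (hG : G.IsGeneratorSet) :
    G.IsCommuting :=
  ⟨fun k => (Pauli.parity_eq_zero_iff _).2 (hG.phase_real k),
    fun k l => (StabOp.commute_iff _ _).1 (hG.commute k l)⟩

/-- Conjugation by a unitary is multiplicative and fixes 1, so it passes through the ordered product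
of projectors. -/
lemma state_conj {G G' : StabArray NA NB K}
    {W : Matrix (Bits NA × Bits NB) (Bits NA × Bits NB) ℂ} (hW : Wᴴ * W = 1) (hW' : W * Wᴴ = 1)
    (h : ∀ k, (G' k).toMatrix = W * (G k).toMatrix * Wᴴ) : G'.state = W * G.state * Wᴴ := by
  let φ : Matrix (Bits NA × Bits NB) (Bits NA × Bits NB) ℂ →*
      Matrix (Bits NA × Bits NB) (Bits NA × Bits NB) ℂ :=
    { toFun := fun M => W * M * Wᴴ
      map_one' := by rw [mul_one, hW']
      map_mul' := fun M N => by
        rw [mul_assoc, mul_assoc (W * M), ← mul_assoc Wᴴ (W * N), ← mul_assoc Wᴴ W, hW, one_mul]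
        simp only [mul_assoc] }
  have hφ : ∀ M, φ M = W * M * Wᴴ := fun _ => rfl
  unfold state
  rw [mul_smul_comm, smul_mul_assoc, ← hφ, map_list_prod, List.map_ofFn]
  congr 3
  funext k
  simp only [Function.comp, hφ, h, mul_smul_comm, smul_mul_assoc, mul_add, add_mul, mul_one, hW']

lemma locallyEquivalent_state {G G' : StabArray NA NB K} {U : Matrix (Bits NA) (Bits NA) ℂ}
    {V : Matrix (Bits NB) (Bits NB) ℂ} (hU : Uᴴ * U = 1) (hV : Vᴴ * V = 1)
    (h : ∀ k, (G' k).toMatrix = (U ⊗ₖ V) * (G k).toMatrix * (U ⊗ₖ V)ᴴ) :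
    LocallyEquivalent G.state G'.state := by
  have hU' := mul_eq_one_comm.1 hU
  have hV' := mul_eq_one_comm.1 hV
  exact ⟨U, V, hU, hU', hV, hV', state_conj (kronecker_unitary hU hV)
    (kronecker_unitary' hU' hV') h⟩

lemma locallyEquivalent_gate (G : StabArray NA NB K) (u : QubitGate) (q : Qubit NA NB) :
    LocallyEquivalent G.state (state fun k => (G k).applyGate u q) := by
  let M : Qubit NA NB → Matrix (Fin 2) (Fin 2) ℂ := Function.update (fun _ => 1) q u.toMatrix
  have hM : ∀ r, (M r)ᴴ * M r = 1 := by
    intro r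
    by_cases hr : r = q
    · subst hr; simp [M, u.toMatrix_unitary]
    · simp [M, hr]
  refine locallyEquivalent_state (piKron_unitary fun i => hM (.inl i))
    (piKron_unitary fun i => hM (.inr i)) fun k => ?_
  refine StabOp.toMatrix_conj M (Pi.single q (u.act ((G k).op q)).1) (fun r => ?_) ?_
  · by_cases hr : r = q
    · subst hr; simp [M, StabOp.applyGate, u.toMatrix_conj]
    · simp [M, hr, StabOp.applyGate, iPow_zero]
  · simp [StabOp.applyGate]

lemma locallyEquivalent_relabel {G G' : StabArray NA NB K} (e : Bits NA ≃ Bits NA)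
    (f : Bits NB ≃ Bits NB)
    (h : ∀ k, (G' k).toMatrix = (G k).toMatrix.submatrix (Prod.map e f) (Prod.map e f)) :
    LocallyEquivalent G.state G'.state :=
  locallyEquivalent_state (relabelMatrix_unitary e) (relabelMatrix_unitary f) fun k => by
    rw [h k, submatrix_eq_conj]

/-- The action of a CNOT on the computational basis. -/
def cnotEquiv {ι : Type} [DecidableEq ι] {c t : ι} (h : c ≠ t) : (ι → Fin 2) ≃ (ι → Fin 2) :=
  Function.Involutive.toPerm (fun x => Function.update x t (x t + x c)) (by
    intro x
    have h2 : ∀ a b : Fin 2, a + b + b = a := by decide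
    funext i
    by_cases hi : i = t
    · subst hi; simp [h, h2]
    · simp [hi])

@[simp] lemma cnotEquiv_apply {ι : Type} [DecidableEq ι] {c t : ι} (h : c ≠ t) (x : ι → Fin 2)
    (i : ι) : cnotEquiv h x i = if i = t then x t + x c else x i := by
  simp [cnotEquiv, Function.Involutive.toPerm, Function.update_apply]

-- The CNOT is the involution `(x, y) ↦ (x, y + x)` of basis labels, so conjugation by it merely
-- shifts the target indices of a matrix entry.
set_option maxHeartbeats 1000000 in
lemma cnotTable_toMatrix (a b : Pauli) (x y u v : Fin 2) :
    iPow (cnotTable a b).1 * ((cnotTable a b).2.1.toMatrix x u *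
      (cnotTable a b).2.2.toMatrix y v) = a.toMatrix x u * b.toMatrix (y + x) (v + u) := by
  cases a <;> cases b <;> fin_cases x <;> fin_cases y <;> fin_cases u <;> fin_cases v <;>
    simp [cnotTable, Pauli.toMatrix, iPow_zero, iPow_two, Matrix.one_apply]

/-- The maps `e` and `f` keep the two parties symmetric: one of them will be the CNOT of a party and
the other the identity. -/
lemma toMatrix_applyCNOT {c t : Qubit NA NB} (hct : c ≠ t) (g : StabOp NA NB)
    (e : Bits NA → Bits NA) (f : Bits NB → Bits NB)
    (hef : ∀ (x : Bits NA × Bits NB) q,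
      Sum.elim (e x.1) (f x.2) q = cnotEquiv hct (Sum.elim x.1 x.2) q) :
    (g.applyCNOT c t).toMatrix = g.toMatrix.submatrix (Prod.map e f) (Prod.map e f) := by
  have hsub : ({c, t} : Finset (Qubit NA NB)) ⊆ Finset.univ := Finset.subset_univ _
  ext x y
  simp only [StabOp.toMatrix, Matrix.submatrix_apply, Matrix.of_apply, Prod.map_fst, Prod.map_snd,
    hef]
  rw [← Finset.prod_sdiff hsub, ← Finset.prod_sdiff hsub, Finset.prod_pair hct,
    Finset.prod_pair hct]
  have key := cnotTable_toMatrix (g.op c) (g.op t) (Sum.elim x.1 x.2 c) (Sum.elim x.1 x.2 t)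
    (Sum.elim y.1 y.2 c) (Sum.elim y.1 y.2 t)
  simp only [cnotEquiv_apply, hct, if_true, if_false, ← key, StabOp.applyCNOT, ne_eq,
    not_false_eq_true, Function.update_self, Function.update_of_ne]
  have hadd := iPow_add g.phase (cnotTable (g.op c) (g.op t)).1
  unfold iPow at hadd ⊢
  rw [hadd, mul_assoc]
  congr 1
  rw [mul_left_comm]
  congr 1
  refine Finset.prod_congr rfl fun q hq => ?_
  simp only [Finset.mem_sdiff, Finset.mem_univ, Finset.mem_insert, Finset.mem_singleton,
    true_and, not_or] at hq
  simp [hq.1, hq.2]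

lemma toMatrix_swapColumns (q r : Qubit NA NB) (g : StabOp NA NB)
    (e : Bits NA → Bits NA) (f : Bits NB → Bits NB)
    (hef : ∀ (x : Bits NA × Bits NB) s,
      Sum.elim (e x.1) (f x.2) s = Sum.elim x.1 x.2 (Equiv.swap q r s)) :
    (g.swapColumns q r).toMatrix = g.toMatrix.submatrix (Prod.map e f) (Prod.map e f) := by
  ext x y
  simp only [StabOp.toMatrix, Matrix.submatrix_apply, Matrix.of_apply, Prod.map_fst, Prod.map_snd,
    hef, StabOp.swapColumns]
  congr 1
  exact Fintype.prod_equiv (Equiv.swap q r) _ _ fun s => by simp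

lemma locallyEquivalent_cnot (G : StabArray NA NB K) {c t : Qubit NA NB} (hct : c ≠ t)
    (hp : c.SameParty t) : LocallyEquivalent G.state (state fun k => (G k).applyCNOT c t) := by
  rcases c with c | c <;> rcases t with t | t
  · have h : c ≠ t := fun h => hct (congrArg _ h)
    refine locallyEquivalent_relabel (cnotEquiv h) (Equiv.refl _) fun k =>
      toMatrix_applyCNOT hct _ _ _ ?_
    rintro x (i | i) <;> simp
  · simp [Qubit.SameParty] at hp
  · simp [Qubit.SameParty] at hp
  · have h : c ≠ t := fun h => hct (congrArg _ h)
    refine locallyEquivalent_relabel (Equiv.refl _) (cnotEquiv h) fun k =>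
      toMatrix_applyCNOT hct _ _ _ ?_
    rintro x (i | i) <;> simp

lemma locallyEquivalent_colSwap (G : StabArray NA NB K) {q r : Qubit NA NB}
    (hp : q.SameParty r) : LocallyEquivalent G.state (state fun k => (G k).swapColumns q r) := by
  rcases q with q | q <;> rcases r with r | r
  · refine locallyEquivalent_relabel ((Equiv.swap q r).arrowCongr (Equiv.refl _)) (Equiv.refl _)
      fun k => toMatrix_swapColumns _ _ _ _ _ ?_
    rintro x (i | i)
    · rw [← Equiv.Perm.sumCongr_swap_refl]; rfl
    · rw [← Equiv.Perm.sumCongr_swap_refl]; rfl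
  · simp [Qubit.SameParty] at hp
  · simp [Qubit.SameParty] at hp
  · refine locallyEquivalent_relabel (Equiv.refl _) ((Equiv.swap q r).arrowCongr (Equiv.refl _))
      fun k => toMatrix_swapColumns _ _ _ _ _ ?_
    rintro x (i | i)
    · rw [← Equiv.Perm.sumCongr_refl_swap]; rfl
    · rw [← Equiv.Perm.sumCongr_refl_swap]; rfl

/-- In a commutative ring the ordered products become products over finite sets, which can be
reordered and expanded. Injectivity of `φ` transfers `g² = 1` to the lifts. -/
lemma IsCommuting.exists_lift {G : StabArray NA NB K} (hG : G.IsCommuting) :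
    ∃ (R : Type) (_ : CommRing R) (_ : Algebra ℂ R)
      (φ : R →ₐ[ℂ] Matrix (Bits NA × Bits NB) (Bits NA × Bits NB) ℂ) (g : Fin K → R),
      Function.Injective φ ∧ (∀ k, φ (g k) = (G k).toMatrix) ∧ ∀ k, g k * g k = 1 := by
  obtain ⟨R, _, _, φ, g, hφ, hg⟩ := exists_commRing_lift (fun k => (G k).toMatrix) hG.commute
  refine ⟨R, _, _, φ, g, hφ, hg, fun k => hφ ?_⟩
  rw [map_mul, hg, map_one, StabOp.toMatrix_sq (hG.parity k)]

lemma state_eq_lift {G : StabArray NA NB K} {R : Type} [CommRing R] [Algebra ℂ R]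
    (φ : R →ₐ[ℂ] Matrix (Bits NA × Bits NB) (Bits NA × Bits NB) ℂ) {g : Fin K → R}
    (hg : ∀ k, φ (g k) = (G k).toMatrix) : G.state = (2 : ℂ) ^ ((K : ℤ) - ((NA + NB : ℕ) : ℤ)) •
      φ (∏ k, (2⁻¹ : ℂ) • (1 + g k)) := by
  rw [state, ← map_prod_ofFn]
  simp [hg]

lemma state_rowSwap {G : StabArray NA NB K} (hG : G.IsCommuting) (k l : Fin K) :
    state (G ∘ Equiv.swap k l) = G.state := by
  obtain ⟨R, _, _, φ, g, -, hg, -⟩ := hG.exists_lift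
  rw [state_eq_lift φ hg,
    state_eq_lift (G := G ∘ Equiv.swap k l) φ (g := g ∘ Equiv.swap k l) fun k => hg _]
  congr 2
  exact Equiv.prod_comp (Equiv.swap k l) fun k => (2⁻¹ : ℂ) • (1 + g k)

/-- Because `g² = 1`, one has `(1 + g)(1 + gh) = (1 + g)(1 + h)`; the other factors are untouched.
-/
lemma state_rowMul {G : StabArray NA NB K} (hG : G.IsCommuting) {k l : Fin K} (hkl : k ≠ l) :
    state (Function.update G l ((G k).mul (G l))) = G.state := by
  obtain ⟨R, _, _, φ, g, -, hg, hsq⟩ := hG.exists_lift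
  rw [state_eq_lift φ hg, state_eq_lift φ (g := Function.update g l (g k * g l)) fun j => ?_]
  · congr 2
    rw [← Finset.mul_prod_erase _ _ (Finset.mem_univ l),
      ← Finset.mul_prod_erase _ (fun k => (2⁻¹ : ℂ) • (1 + g k)) (Finset.mem_univ l),
      ← Finset.mul_prod_erase _ _ (Finset.mem_erase.2 ⟨hkl, Finset.mem_univ k⟩),
      ← Finset.mul_prod_erase _ (fun k => (2⁻¹ : ℂ) • (1 + g k))
        (Finset.mem_erase.2 ⟨hkl, Finset.mem_univ k⟩), ← mul_assoc, ← mul_assoc]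
    congr 1
    · simp only [Function.update_self, Function.update_of_ne hkl, smul_mul_smul_comm]
      congr 1
      linear_combination (g l) * hsq k
    · refine Finset.prod_congr rfl fun j hj => ?_
      rw [Function.update_of_ne]
      rintro rfl
      simp at hj
  · by_cases hj : j = l
    · subst hj; simp [hg, StabOp.toMatrix_mul]
    · simp [hj, hg]

lemma IsCommuting.locallyEquivalent_step {G G' : StabArray NA NB K} (hG : G.IsCommuting)
    (h : Step G G') : LocallyEquivalent G.state G'.state := by
  cases h with
  | rowSwap k l => rw [state_rowSwap hG]; exact .refl _
  | rowMul k l hkl => rw [state_rowMul hG hkl]; exact .refl _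
  | gate u q => exact locallyEquivalent_gate G u q
  | cnot c t hct hp => exact locallyEquivalent_cnot G hct hp
  | colSwap q r hp => exact locallyEquivalent_colSwap G hp

lemma IsCommuting.locallyEquivalent_reaches {G G' : StabArray NA NB K} (hG : G.IsCommuting)
    (h : G.Reaches G') : LocallyEquivalent G.state G'.state := by
  induction h with
  | refl => exact .refl _
  | tail h₁ h₂ ih => exact ih.trans ((hG.reaches h₁).locallyEquivalent_step h₂)

/-! ## The trace of a stabiliser state -/

lemma exists_toMatrix_prod (l : List (StabOp NA NB)) :
    ∃ h : StabOp NA NB, h.toMatrix = (l.map StabOp.toMatrix).prod := by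
  induction l with
  | nil => exact ⟨⟨0, fun _ => .I⟩, by
      simp [StabOp.toMatrix_eq, Pauli.toMatrix, iPow_zero, qubitTensor_one]⟩
  | cons g l ih =>
    obtain ⟨h, hh⟩ := ih
    exact ⟨g.mul h, by simp [StabOp.toMatrix_mul, hh]⟩

/-- Some Pauli operator on the qubit `q` anticommutes with `h`. Conjugation by it changes the sign
of `h` but preserves the trace. -/
lemma trace_toMatrix {h : StabOp NA NB} {q : Qubit NA NB} (hq : h.op q ≠ .I) :
    h.toMatrix.trace = 0 := by
  obtain ⟨a, ha⟩ : ∃ a : Pauli, a.anti (h.op q) = 1 := by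
    cases hh : h.op q with
    | I => exact absurd hh hq
    | X => exact ⟨.Z, rfl⟩
    | Y => exact ⟨.Z, rfl⟩
    | Z => exact ⟨.X, rfl⟩
  let d : StabOp NA NB := ⟨0, fun r => if r = q then a else .I⟩
  have hf : StabOp.form Finset.univ d h = 1 := by
    rw [form_eq_of_single (Finset.mem_univ q) (a := a) fun r _ => rfl, ha]
  have h1 := StabOp.toMatrix_comm d h
  rw [hf, signOf, if_neg (by decide), neg_one_smul] at h1
  have h2 := congrArg (fun M => (d.toMatrixᴴ * M).trace) h1
  simp only [← mul_assoc, StabOp.toMatrix_unitary, one_mul, mul_neg, Matrix.trace_neg] at h2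
  rw [Matrix.trace_mul_comm, ← mul_assoc, mul_eq_one_comm.1 (StabOp.toMatrix_unitary d), one_mul,
    eq_neg_iff_add_eq_zero, ← two_mul] at h2
  exact (mul_eq_zero.1 h2).resolve_left two_ne_zero

/-- Expand the product of projectors into products of generators over subsets. Such a product with
nonzero trace is a scalar with square 1: the value 1 contradicts independence for a nonempty subset,
and -1 is excluded. Only the empty subset contributes, and the powers of 2 cancel. -/
lemma IsGeneratorSet.trace_state {G : StabArray NA NB K} (hG : G.IsGeneratorSet) :
    G.state.trace = 1 := by
  obtain ⟨R, _, _, φ, g, hφ, hg, hsq⟩ := hG.isCommuting.exists_lift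
  have hprod : ∀ s : Fin K → ℕ, (List.ofFn fun k => (G k).toMatrix ^ s k).prod =
      φ (∏ k, g k ^ s k) := by
    intro s
    rw [← map_prod_ofFn]
    simp [hg]
  have hzero : ∀ S : Finset (Fin K), S ≠ ∅ → (φ (∏ k ∈ S, g k)).trace = 0 := by
    intro S hS
    let s : Fin K → ℕ := fun k => if k ∈ S then 1 else 0
    have hs : ∏ k ∈ S, g k = ∏ k, g k ^ s k := by simp [s, Finset.prod_ite_mem]
    obtain ⟨h, hh⟩ := exists_toMatrix_prod ((List.finRange K).filter (· ∈ S) |>.map G)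
    have hh' : h.toMatrix = φ (∏ k ∈ S, g k) := by
      have hfun : StabOp.toMatrix ∘ G = φ ∘ g := funext fun k => (hg k).symm
      rw [hh, List.map_map, hfun, ← List.map_map, ← map_list_prod]
      congr 1
      rw [← List.prod_toFinset _ ((List.nodup_finRange K).filter _)]
      refine Finset.prod_congr ?_ fun _ _ => rfl
      ext; simp
    rw [← hh']
    by_contra hne
    have hI : ∀ q, h.op q = .I := fun q => by
      by_contra hq
      exact hne (trace_toMatrix hq)
    have hop : h.toMatrix = iPow h.phase • 1 := by
      rw [StabOp.toMatrix_eq]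
      simp only [hI, Pauli.toMatrix, qubitTensor_one]
    have hsq' : h.toMatrix * h.toMatrix = 1 := by
      rw [hh', ← map_mul, ← Finset.prod_mul_distrib]
      simp [hsq]
    have hone : iPow h.phase * iPow h.phase = 1 := by
      rw [hop, smul_mul_smul_comm, mul_one] at hsq'
      have := congrFun (congrFun hsq' (fun _ => 0, fun _ => 0)) (fun _ => 0, fun _ => 0)
      simpa using this
    rcases mul_self_eq_one_iff.1 hone with h1 | h1
    · rw [h1, one_smul, hh', hs, ← hprod] at hop
      obtain ⟨k, hk⟩ := Finset.nonempty_iff_ne_empty.2 hS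
      have := (hG.independent s).1 hop k
      simp [s, hk] at this
    · rw [h1, neg_one_smul, hh', hs, ← hprod] at hop
      exact hG.ne_neg_one s hop
  have hexp : ∏ k, (2⁻¹ : ℂ) • (1 + g k) =
      (2⁻¹ : ℂ) ^ K • ∑ S ∈ Finset.univ.powerset, ∏ k ∈ S, g k := by
    rw [← Finset.prod_one_add, Finset.prod_smul, Finset.prod_const, Finset.card_univ,
      Fintype.card_fin]
  rw [state_eq_lift φ hg, hexp, map_smul, map_sum, Matrix.trace_smul, Matrix.trace_smul,
    Matrix.trace_sum, Finset.sum_eq_single_of_mem ∅ (by simp) fun S _ hS => hzero S hS]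
  simp only [Finset.prod_empty, map_one, Matrix.trace_one, Fintype.card_prod, Fintype.card_fun,
    Fintype.card_fin, smul_eq_mul]
  push_cast
  rw [zpow_sub₀ two_ne_zero, zpow_natCast, ← Nat.cast_add, zpow_natCast, pow_add, inv_pow]
  field_simp

end StabArray

/-! ## The EPR state -/

lemma pairState_zero : pairState 0 0 = EPR := by
  have h2 : ((√2 : ℝ) : ℂ)⁻¹ * ((√2 : ℝ) : ℂ)⁻¹ = 2⁻¹ := by
    rw [← mul_inv, ← Complex.ofReal_mul, Real.mul_self_sqrt (by norm_num)]; norm_num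
  ext ⟨i, j⟩ ⟨k, l⟩
  simp only [pairState, EPR, Matrix.vecMulVec_apply, Matrix.mul_apply, Fintype.sum_prod_type,
    Fin.sum_univ_two, Matrix.smul_apply, Matrix.add_apply, Matrix.kroneckerMap_apply,
    Pauli.toMatrix, Pi.star_apply, eprVec]
  fin_cases i <;> fin_cases j <;> fin_cases k <;> fin_cases l <;>
    simp [h2, Matrix.one_apply] <;> norm_num

lemma Pauli.kronecker_one_mul (a b : Pauli) (c : ℂ) :
    (a.toMatrix ⊗ₖ 1) * ((2⁻¹ : ℂ) • (1 + c • (b.toMatrix ⊗ₖ b.toMatrix))) =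
      ((2⁻¹ : ℂ) • (1 + (signOf (a.anti b) * c) • (b.toMatrix ⊗ₖ b.toMatrix))) *
        (a.toMatrix ⊗ₖ (1 : Matrix (Fin 2) (Fin 2) ℂ)) := by
  simp only [mul_smul_comm, smul_mul_assoc, mul_add, add_mul, mul_one, one_mul,
    ← Matrix.mul_kronecker_mul, Pauli.toMatrix_comm a b, Matrix.smul_kronecker, smul_smul,
    mul_comm c]

/-- A Pauli operator on one of the qubits changes the signs of a pair state. -/
lemma pairState_sign (a : Pauli) {s t s' t' : ZMod 4}
    (hs : iPow s' = signOf (a.anti .X) * iPow s) (ht : iPow t' = signOf (a.anti .Z) * iPow t) :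
    LocallyEquivalent (pairState s t) (pairState s' t') := by
  have ha : a.toMatrixᴴ * a.toMatrix = 1 := by rw [a.conjTranspose_toMatrix, a.toMatrix_sq]
  have ha' := mul_eq_one_comm.1 ha
  refine ⟨a.toMatrix, 1, ha, ha', by simp, by simp, ?_⟩
  unfold iPow at hs ht
  symm
  rw [pairState, ← mul_assoc, Pauli.kronecker_one_mul, mul_assoc _ (a.toMatrix ⊗ₖ _),
    Pauli.kronecker_one_mul, ← hs, ← ht, ← mul_assoc, mul_assoc,
    kronecker_unitary' ha' (by simp), mul_one]
  rfl

/-- The four sign patterns are the four Bell states, which a Pauli operator on A permutes: `X`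
repairs `t`, `Z` repairs `s`, and `Y` repairs both. -/
lemma pairState_locallyEquivalent {s t : ZMod 4} (hs : Pauli.parity s = 0)
    (ht : Pauli.parity t = 0) : LocallyEquivalent (pairState s t) EPR := by
  rw [← pairState_zero]
  rcases (Pauli.parity_eq_zero_iff _).1 hs with rfl | rfl <;>
    rcases (Pauli.parity_eq_zero_iff _).1 ht with rfl | rfl
  · exact .refl _
  · exact pairState_sign .X (by simp [signOf]) (by simp [signOf, Pauli.anti, iPow_zero, iPow_two])
  · exact pairState_sign .Z (by simp [signOf, Pauli.anti, iPow_zero, iPow_two]) (by simp [signOf])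
  · exact pairState_sign .Y (by simp [signOf, Pauli.anti, iPow_zero, iPow_two])
      (by simp [signOf, Pauli.anti, iPow_zero, iPow_two])

lemma trace_EPR : EPR.trace = 1 := by
  rw [← pairState_zero, pairState]
  simp [Pauli.toMatrix, Matrix.trace, Matrix.mul_apply, Fintype.sum_prod_type,
    Matrix.one_apply]
  norm_num

/-! ## Tensor products of bipartite states -/

section biTensor

variable {a b a' b' : Type}

lemma biTensor_eq (ρ : Matrix (a × b) (a × b) ℂ) (σ : Matrix (a' × b') (a' × b') ℂ) :
    biTensor ρ σ = (ρ ⊗ₖ σ).submatrix (Equiv.prodProdProdComm a a' b b')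
      (Equiv.prodProdProdComm a a' b b') := rfl

lemma biTensor_mul [Fintype a] [Fintype b] [Fintype a'] [Fintype b']
    (ρ ρ' : Matrix (a × b) (a × b) ℂ) (σ σ' : Matrix (a' × b') (a' × b') ℂ) :
    biTensor ρ σ * biTensor ρ' σ' = biTensor (ρ * ρ') (σ * σ') := by
  rw [biTensor_eq, biTensor_eq, biTensor_eq, Matrix.submatrix_mul_equiv, Matrix.mul_kronecker_mul]

lemma biTensor_one [DecidableEq a] [DecidableEq b] [DecidableEq a'] [DecidableEq b'] :
    biTensor (1 : Matrix (a × b) (a × b) ℂ) (1 : Matrix (a' × b') (a' × b') ℂ) = 1 := by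
  rw [biTensor_eq, Matrix.one_kronecker_one, Matrix.submatrix_one_equiv]

lemma trace_biTensor [Fintype a] [Fintype b] [Fintype a'] [Fintype b']
    (ρ : Matrix (a × b) (a × b) ℂ) (σ : Matrix (a' × b') (a' × b') ℂ) :
    (biTensor ρ σ).trace = ρ.trace * σ.trace := by
  rw [← Matrix.trace_kronecker]
  exact Fintype.sum_equiv (Equiv.prodProdProdComm a a' b b') _ _ fun _ => rfl

lemma biProd_eq {n : ℕ} (ρ : Fin n → Matrix (a × b) (a × b) ℂ) :
    biProd ρ = (piKron ρ).submatrix (Equiv.arrowProdEquivProdArrow (Fin n) _ _).symm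
      (Equiv.arrowProdEquivProdArrow (Fin n) _ _).symm := rfl

lemma biProd_mul [Fintype a] [Fintype b] {n : ℕ} (ρ σ : Fin n → Matrix (a × b) (a × b) ℂ) :
    biProd ρ * biProd σ = biProd fun i => ρ i * σ i := by
  rw [biProd_eq, biProd_eq, biProd_eq, Matrix.submatrix_mul_equiv, piKron_mul]

lemma biProd_one [DecidableEq a] [DecidableEq b] {n : ℕ} :
    biProd (fun _ : Fin n => (1 : Matrix (a × b) (a × b) ℂ)) = 1 := by
  classical
  rw [biProd_eq, piKron_one, Matrix.submatrix_one_equiv]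

lemma trace_biProd [Fintype a] [Fintype b] {n : ℕ} (ρ : Fin n → Matrix (a × b) (a × b) ℂ) :
    (biProd ρ).trace = ∏ i, (ρ i).trace := by
  simp only [Matrix.trace, Matrix.diag]
  rw [Finset.prod_univ_sum, Fintype.piFinset_univ]
  exact Fintype.sum_equiv (Equiv.arrowProdEquivProdArrow (Fin n) _ _).symm _ _ fun _ => rfl

/-- Local unitaries on the factors of a tensor product. -/
lemma LocallyEquivalent.biTensor_left [Fintype a] [DecidableEq a] [Fintype b] [DecidableEq b]
    [Fintype a'] [DecidableEq a'] [Fintype b'] [DecidableEq b'] {c d : Type} [Fintype c]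
    [DecidableEq c] [Fintype d] [DecidableEq d] {ρ : Matrix (a × b) (a × b) ℂ}
    {ρ' : Matrix (c × d) (c × d) ℂ} (h : LocallyEquivalent ρ ρ')
    (σ : Matrix (a' × b') (a' × b') ℂ) : LocallyEquivalent (biTensor ρ σ) (biTensor ρ' σ) := by
  obtain ⟨U, V, h1, h2, h3, h4, rfl⟩ := h
  refine ⟨U ⊗ₖ 1, V ⊗ₖ 1, kronecker_unitary h1 (by simp), kronecker_unitary' h2 (by simp),
    kronecker_unitary h3 (by simp), kronecker_unitary' h4 (by simp), ?_⟩
  -- Grouping by party and grouping by factor differ by an exchange of the two middle systems.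
  have hW : (U ⊗ₖ (1 : Matrix a' a' ℂ)) ⊗ₖ (V ⊗ₖ (1 : Matrix b' b' ℂ)) =
      ((U ⊗ₖ V) ⊗ₖ (1 : Matrix (a' × b') (a' × b') ℂ)).submatrix
        (Equiv.prodProdProdComm c a' d b') (Equiv.prodProdProdComm a a' b b') := by
    ext x y
    simp only [Matrix.kroneckerMap_apply, Matrix.submatrix_apply, Equiv.prodProdProdComm_apply,
      Matrix.one_apply, Prod.ext_iff, ite_and]
    split_ifs <;> ring
  rw [hW, Matrix.conjTranspose_submatrix, biTensor_eq, biTensor_eq, Matrix.submatrix_mul_equiv,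
    Matrix.submatrix_mul_equiv, Matrix.conjTranspose_kronecker (U ⊗ₖ V) 1,
    ← Matrix.mul_kronecker_mul,
    ← Matrix.mul_kronecker_mul]
  simp

lemma LocallyEquivalent.biProd [Fintype a] [DecidableEq a] [Fintype b] [DecidableEq b]
    [Fintype a'] [DecidableEq a'] [Fintype b'] [DecidableEq b'] {n : ℕ}
    {ρ : Fin n → Matrix (a × b) (a × b) ℂ} {σ : Fin n → Matrix (a' × b') (a' × b') ℂ}
    (h : ∀ i, LocallyEquivalent (ρ i) (σ i)) :
    LocallyEquivalent (_root_.biProd ρ) (_root_.biProd σ) := by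
  choose U V h1 h2 h3 h4 h5 using h
  obtain rfl : σ = _ := funext h5
  refine ⟨piKron U, piKron V, piKron_unitary h1, piKron_unitary' h2, piKron_unitary h3,
    piKron_unitary' h4, ?_⟩
  have hW : piKron U ⊗ₖ piKron V = (piKron fun i => U i ⊗ₖ V i).submatrix
      (Equiv.arrowProdEquivProdArrow (Fin n) _ _).symm
      (Equiv.arrowProdEquivProdArrow (Fin n) _ _).symm := by
    ext x y
    simp [piKron, Equiv.arrowProdEquivProdArrow, Finset.prod_mul_distrib]
  rw [hW, Matrix.conjTranspose_submatrix, biProd_eq, biProd_eq, Matrix.submatrix_mul_equiv,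
    Matrix.submatrix_mul_equiv, piKron_conjTranspose, piKron_mul, piKron_mul]

end biTensor

/-! ## Splitting the qubits -/

/-- `joinBits` as an equivalence. -/
def joinEquiv {p n : ℕ} (h : p ≤ n) : Bits p × Bits (n - p) ≃ Bits n where
  toFun := joinBits
  invFun x := (fun i => x ⟨i, by omega⟩, fun i => x ⟨p + i, by omega⟩)
  left_inv x := by
    ext i <;> simp [joinBits]
  right_inv x := by
    funext i
    by_cases hi : (i : ℕ) < p
    · simp [joinBits, hi]
    · simp [joinBits, hi, Nat.add_sub_cancel' (not_lt.1 hi)]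

lemma Fin.prod_univ_split {p n : ℕ} (h : p ≤ n) (f : Fin n → ℂ) :
    ∏ i, f i = (∏ i : Fin p, f ⟨i, by omega⟩) * ∏ i : Fin (n - p), f ⟨p + i, by omega⟩ := by
  obtain ⟨m, rfl⟩ := Nat.exists_eq_add_of_le h
  rw [Fin.prod_univ_add]
  congr 1
  exact Fintype.prod_equiv (finCongr (by omega)) _ _ fun _ => rfl

/-- The order of the factors is kept, so this holds in any monoid; each block of two rows will
become one pair state. -/
lemma List.prod_ofFn_pairs {A : Type*} [Monoid A] {p n : ℕ} (h : 2 * p ≤ n) (f : Fin n → A) :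
    (List.ofFn f).prod = (List.ofFn fun i : Fin p => f ⟨2 * i, by omega⟩ *
      f ⟨2 * i + 1, by omega⟩).prod * (List.ofFn fun i : Fin (n - 2 * p) =>
        f ⟨2 * p + i, by omega⟩).prod := by
  obtain ⟨m, rfl⟩ := Nat.exists_eq_add_of_le h
  rw [List.ofFn_add, List.prod_append, List.ofFn_mul', List.prod_flatten, List.map_ofFn,
    List.ofFn_congr (show m = 2 * p + m - 2 * p by omega)]
  congr 2
  congr 1
  funext i
  simp [List.ofFn_succ]

/-- At each index only one factor differs from 1. This assembles operators on single pairs into one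
tensor product, in a setting without commutativity. -/
lemma List.prod_ofFn_single {A : Type*} [Monoid A] {n : ℕ} (f : Fin n → A) :
    (List.ofFn fun i : Fin n => (Pi.mulSingle i (f i) : Fin n → A)).prod = f := by
  funext j
  rw [Pi.list_prod_apply, List.map_ofFn]
  have : ∀ (n : ℕ) (f : Fin n → A) (j : Fin n),
      (List.ofFn fun i : Fin n => if i = j then f i else 1).prod = f j := by
    intro n
    induction n with
    | zero => exact fun _ j => j.elim0
    | succ n ih =>
      intro f j
      rw [List.ofFn_succ, List.prod_cons]
      cases j using Fin.cases with
      | zero => simp [Fin.succ_ne_zero, List.ofFn_const]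
      | succ j => simp [(Fin.succ_ne_zero j).symm, ih (fun i => f i.succ)]
  rw [← this n f j]
  congr 2
  funext i
  by_cases h : i = j
  · subst h; simp
  · simp [h]

section split

variable {NA NB p : ℕ}

lemma splitQubits_eq (hA : p ≤ NA) (hB : p ≤ NB)
    (ρ : Matrix (Bits NA × Bits NB) (Bits NA × Bits NB) ℂ) :
    splitQubits p ρ = ρ.submatrix ((joinEquiv hA).prodCongr (joinEquiv hB))
      ((joinEquiv hA).prodCongr (joinEquiv hB)) := rfl

lemma splitQubits_mul (hA : p ≤ NA) (hB : p ≤ NB)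
    (ρ σ : Matrix (Bits NA × Bits NB) (Bits NA × Bits NB) ℂ) :
    splitQubits p (ρ * σ) = splitQubits p ρ * splitQubits p σ := by
  simp only [splitQubits_eq hA hB, Matrix.submatrix_mul_equiv]

lemma splitQubits_one (hA : p ≤ NA) (hB : p ≤ NB) :
    splitQubits (NA := NA) (NB := NB) p 1 = 1 := by
  rw [splitQubits_eq hA hB, Matrix.submatrix_one_equiv]

lemma splitQubits_qubitTensor (hA : p ≤ NA) (hB : p ≤ NB)
    (M : Qubit NA NB → Matrix (Fin 2) (Fin 2) ℂ) :
    splitQubits p (qubitTensor M) = biTensor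
      (biProd fun i : Fin p => M (.inl ⟨i, by omega⟩) ⊗ₖ M (.inr ⟨i, by omega⟩))
      (qubitTensor (NA := NA - p) (NB := NB - p)
        (Sum.elim (fun i => M (.inl ⟨p + i, by omega⟩)) fun i => M (.inr ⟨p + i, by omega⟩))) := by
  ext x y
  simp only [splitQubits, qubitTensor, Matrix.submatrix_apply, Matrix.kroneckerMap_apply,
    Prod.map_fst, Prod.map_snd, piKron, Matrix.of_apply, biTensor, biProd, Sum.elim_inl,
    Sum.elim_inr, Finset.prod_mul_distrib]
  rw [Fin.prod_univ_split hA, Fin.prod_univ_split hB]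
  simp [joinBits]
  ring

end split

/-! ## The state of a normal form -/

section

variable {a b : Type} [DecidableEq a] [DecidableEq b]

lemma biProd_mulSingle_apply {n : ℕ} (i : Fin n) (A : Matrix (a × b) (a × b) ℂ)
    (x y : (Fin n → a) × (Fin n → b)) :
    biProd (Pi.mulSingle i A) x y = A (x.1 i, x.2 i) (y.1 i, y.2 i) *
      ∏ j ∈ Finset.univ.erase i, (1 : Matrix (a × b) (a × b) ℂ) (x.1 j, x.2 j) (y.1 j, y.2 j) := by
  rw [biProd, Matrix.of_apply, ← Finset.mul_prod_erase _ _ (Finset.mem_univ i),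
    Pi.mulSingle_eq_same]
  congr 1
  exact Finset.prod_congr rfl fun j hj => by
    rw [Pi.mulSingle_eq_of_ne (Finset.ne_of_mem_erase hj)]

/-- A tensor product is linear in the factor at `i`, and with all factors 1 it is the identity. -/
lemma biProd_mulSingle_projector {n : ℕ} (i : Fin n) (A : Matrix (a × b) (a × b) ℂ) (c d : ℂ) :
    biProd (Pi.mulSingle i (c • (1 + d • A))) = c • (1 + d • biProd (Pi.mulSingle i A)) := by
  have h1 : (1 : Matrix ((Fin n → a) × (Fin n → b)) ((Fin n → a) × (Fin n → b)) ℂ) =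
      biProd (Pi.mulSingle i 1) := by
    rw [Pi.mulSingle_one]; exact biProd_one.symm
  ext x y
  rw [h1]
  simp only [Matrix.smul_apply, Matrix.add_apply, biProd_mulSingle_apply, smul_eq_mul]
  ring

end

namespace StabArray

variable {NA NB K p : ℕ}

lemma NormalForm.splitQubits_pair {G : StabArray NA NB K} (hN : G.NormalForm p) (i : Fin p)
    {k : Fin K} {a : Pauli} (hk : (k : ℕ) / 2 = i)
    (ha : (if (k : ℕ) % 2 = 0 then Pauli.X else .Z) = a) :
    splitQubits p (G k).toMatrix =
      iPow (G k).phase • biTensor (biProd (Pi.mulSingle i (a.toMatrix ⊗ₖ a.toMatrix))) 1 := by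
  have hq : ∀ q, (G k).op q = if q.pos = i then a else .I := fun q => by
    rw [hN.pair_rows k q (by omega), hk, ha]
  have h1 : splitQubits p (qubitTensor fun q => ((G k).op q).toMatrix) =
      biTensor (biProd (Pi.mulSingle i (a.toMatrix ⊗ₖ a.toMatrix))) 1 := by
    rw [splitQubits_qubitTensor hN.le_A hN.le_B]
    congr 1
    · congr 1
      funext j
      by_cases hj : j = i
      · subst hj; simp [hq, Qubit.pos]
      · have hj' : (j : ℕ) ≠ i := fun h => hj (Fin.ext h)
        simp [hq, Qubit.pos, hj, hj', Pauli.toMatrix]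
    · rw [← qubitTensor_one]
      congr 1
      funext q
      rcases q with q | q
      all_goals
        have : p + (q : ℕ) ≠ i := by omega
        simp [hq, Qubit.pos, this, Pauli.toMatrix]
  rw [← h1, StabOp.toMatrix_eq]
  rfl

lemma NormalForm.splitQubits_lower {G : StabArray NA NB K} (hN : G.NormalForm p)
    (j : Fin (K - 2 * p)) : splitQubits p (G ⟨2 * p + j, by omega⟩).toMatrix =
      biTensor 1 (G.lowerBlock p j).toMatrix := by
  have h1 : splitQubits p (qubitTensor fun q => ((G ⟨2 * p + j, by omega⟩).op q).toMatrix) =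
      biTensor 1 (qubitTensor fun q => ((G.lowerBlock p j).op q).toMatrix) := by
    rw [splitQubits_qubitTensor hN.le_A hN.le_B]
    congr 1
    · rw [← biProd_one]
      congr 1
      funext i
      rw [hN.lower_left _ _ (by simp) (by simp [Qubit.pos]),
        hN.lower_left _ _ (by simp) (by simp [Qubit.pos])]
      simp [Pauli.toMatrix]
  ext x y
  rw [StabOp.toMatrix_eq, StabOp.toMatrix_eq]
  have := congrFun (congrFun h1 x) y
  simp only [biTensor, Matrix.of_apply, Matrix.smul_apply, smul_eq_mul] at this ⊢
  rw [mul_left_comm, ← this]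
  rfl

/-- The state of a normal form is a tensor product of pair states and of the state of the lower
block. -/
lemma NormalForm.splitQubits_state {G : StabArray NA NB K} (hN : G.NormalForm p) :
    splitQubits p G.state =
      biTensor (biProd fun i : Fin p => pairState (G.pairPhase hN.two_mul_le i 0)
        (G.pairPhase hN.two_mul_le i 1)) (G.lowerBlock p).state := by
  -- Splitting, embedding of the pairs and embedding of the lower block are multiplicative, so the
  -- ordered product can be matched factor by factor.
  let φ : Matrix (Bits NA × Bits NB) (Bits NA × Bits NB) ℂ →* _ :=
    { toFun := splitQubits p
      map_one' := splitQubits_one hN.le_A hN.le_B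
      map_mul' := splitQubits_mul hN.le_A hN.le_B }
  let ψ : (Fin p → Matrix (Fin 2 × Fin 2) (Fin 2 × Fin 2) ℂ) →* Matrix
      ((Bits p × Bits (NA - p)) × (Bits p × Bits (NB - p)))
      ((Bits p × Bits (NA - p)) × (Bits p × Bits (NB - p))) ℂ :=
    { toFun := fun M => biTensor (biProd M) 1
      map_one' := by
        rw [show (1 : Fin p → Matrix (Fin 2 × Fin 2) (Fin 2 × Fin 2) ℂ) = fun _ => 1 from rfl,
          biProd_one, biTensor_one]
      map_mul' := fun M N => by rw [biTensor_mul, biProd_mul, one_mul]; rfl }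
  let χ : Matrix (Bits (NA - p) × Bits (NB - p)) (Bits (NA - p) × Bits (NB - p)) ℂ →* Matrix
      ((Bits p × Bits (NA - p)) × (Bits p × Bits (NB - p)))
      ((Bits p × Bits (NA - p)) × (Bits p × Bits (NB - p))) ℂ :=
    { toFun := fun M => biTensor 1 M
      map_one' := biTensor_one
      map_mul' := fun M N => by rw [biTensor_mul, one_mul] }
  have hφ : ∀ M, φ ((2⁻¹ : ℂ) • (1 + M)) = (2⁻¹ : ℂ) • (1 + splitQubits p M) := by
    intro M
    rw [← splitQubits_one hN.le_A hN.le_B]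
    rfl
  have hpair : ∀ (i : Fin p) (k : Fin K) (a : Pauli), (k : ℕ) / 2 = i →
      (if (k : ℕ) % 2 = 0 then Pauli.X else .Z) = a →
      φ ((2⁻¹ : ℂ) • (1 + (G k).toMatrix)) = ψ (Pi.mulSingle i
        ((2⁻¹ : ℂ) • (1 + iPow (G k).phase • (a.toMatrix ⊗ₖ a.toMatrix)))) := by
    intro i k a hk ha
    change _ = biTensor (biProd _) 1
    rw [hφ, hN.splitQubits_pair i hk ha, biProd_mulSingle_projector, ← biTensor_one]
    ext x y
    simp only [biTensor, Matrix.of_apply, Matrix.smul_apply, Matrix.add_apply, smul_eq_mul]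
    ring
  have hlower : ∀ j, φ ((2⁻¹ : ℂ) • (1 + (G ⟨2 * p + (j : Fin (K - 2 * p)), by omega⟩).toMatrix)) =
      χ ((2⁻¹ : ℂ) • (1 + (G.lowerBlock p j).toMatrix)) := by
    intro j
    change _ = biTensor 1 _
    rw [hφ, hN.splitQubits_lower, ← biTensor_one]
    ext x y
    simp only [biTensor, Matrix.of_apply, Matrix.smul_apply, Matrix.add_apply, smul_eq_mul]
    ring
  have hprod : splitQubits p (List.ofFn fun k => (2⁻¹ : ℂ) • (1 + (G k).toMatrix)).prod =
      biTensor (biProd fun i : Fin p => pairState (G.pairPhase hN.two_mul_le i 0)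
        (G.pairPhase hN.two_mul_le i 1))
        (List.ofFn fun k => (2⁻¹ : ℂ) • (1 + (G.lowerBlock p k).toMatrix)).prod := by
    change φ _ = _
    rw [map_list_prod, List.map_ofFn, List.prod_ofFn_pairs hN.two_mul_le]
    have e1 : (fun i : Fin p => (φ ∘ fun k => (2⁻¹ : ℂ) • (1 + (G k).toMatrix))
        ⟨2 * i, by have := hN.two_mul_le; omega⟩ * (φ ∘ fun k => (2⁻¹ : ℂ) • (1 + (G k).toMatrix))
        ⟨2 * i + 1, by have := hN.two_mul_le; omega⟩) =
        ψ ∘ fun i => Pi.mulSingle i (pairState (G.pairPhase hN.two_mul_le i 0)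
          (G.pairPhase hN.two_mul_le i 1)) := by
      funext i
      simp only [Function.comp]
      rw [hpair i _ .X (by simp) (by simp), hpair i _ .Z (by simp; omega) (by simp),
        ← map_mul, ← Pi.mulSingle_mul]
      rfl
    have e2 : (fun j : Fin (K - 2 * p) => (φ ∘ fun k => (2⁻¹ : ℂ) • (1 + (G k).toMatrix))
        ⟨2 * p + j, by omega⟩) =
        χ ∘ fun k => (2⁻¹ : ℂ) • (1 + (G.lowerBlock p k).toMatrix) := funext hlower
    rw [e1, e2, ← List.map_ofFn, ← List.map_ofFn, ← map_list_prod, ← map_list_prod,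
      List.prod_ofFn_single]
    change biTensor _ 1 * biTensor 1 _ = _
    rw [biTensor_mul, one_mul, mul_one]
  -- The pairs take away `2 * p` rows and `2 * p` qubits, so the normalisation is already that of
  -- the lower block.
  have hexp : (K : ℤ) - ((NA + NB : ℕ) : ℤ) =
      ((K - 2 * p : ℕ) : ℤ) - ((NA - p + (NB - p) : ℕ) : ℤ) := by
    have h1 := hN.two_mul_le
    have h2 := hN.le_A
    have h3 := hN.le_B
    omega
  ext x y
  have := congrFun (congrFun hprod x) y
  unfold state
  rw [← hexp]
  simp only [biTensor, splitQubits, Matrix.of_apply, Matrix.smul_apply, Matrix.submatrix_apply,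
    smul_eq_mul] at this ⊢
  rw [this]
  ring

/-! ## Arrays with entries `1` and `X` -/

lemma hadamard_mul_self : ((((√2 : ℝ) : ℂ)⁻¹ • !![(1 : ℂ), 1; 1, -1]) *
    (((√2 : ℝ) : ℂ)⁻¹ • !![(1 : ℂ), 1; 1, -1])) = 1 := by
  have h2 : ((√2 : ℝ) : ℂ)⁻¹ * ((√2 : ℝ) : ℂ)⁻¹ = 2⁻¹ := by
    rw [← mul_inv, ← Complex.ofReal_mul, Real.mul_self_sqrt (by norm_num)]; norm_num
  rw [smul_mul_smul_comm, h2]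
  ext i j
  fin_cases i <;> fin_cases j <;> simp <;> norm_num

lemma hadamard_conjTranspose : (((√2 : ℝ) : ℂ)⁻¹ • !![(1 : ℂ), 1; 1, -1])ᴴ =
    ((√2 : ℝ) : ℂ)⁻¹ • !![(1 : ℂ), 1; 1, -1] := by
  ext i j
  fin_cases i <;> fin_cases j <;> simp [Matrix.conjTranspose_apply]

lemma hadamard_Z : (((√2 : ℝ) : ℂ)⁻¹ • !![(1 : ℂ), 1; 1, -1]) * Pauli.Z.toMatrix =
    Pauli.X.toMatrix * (((√2 : ℝ) : ℂ)⁻¹ • !![(1 : ℂ), 1; 1, -1]) := by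
  simp [Pauli.toMatrix]

lemma hadamardAll_unitary (n : ℕ) : (hadamardAll n)ᴴ * hadamardAll n = 1 :=
  piKron_unitary (M := fun _ : Fin n => ((√2 : ℝ) : ℂ)⁻¹ • !![(1 : ℂ), 1; 1, -1]) fun _ => by
    rw [hadamard_conjTranspose, hadamard_mul_self]

/-- Distinct labels differ at some qubit, where the factor is an off-diagonal entry of a diagonal
matrix. -/
lemma toMatrix_eq_diagonal {g : StabOp NA NB} (hg : ∀ q, g.op q = .I ∨ g.op q = .Z) :
    g.toMatrix = Matrix.diagonal fun x => g.toMatrix x x := by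
  ext x y
  by_cases hxy : x = y
  · subst hxy; simp
  rw [Matrix.diagonal_apply_ne _ hxy, StabOp.toMatrix, Matrix.of_apply]
  have hne : Sum.elim x.1 x.2 ≠ Sum.elim y.1 y.2 := fun h => hxy
    (Prod.ext (funext fun i => congrFun h (.inl i)) (funext fun i => congrFun h (.inr i)))
  obtain ⟨q, hq⟩ := Function.ne_iff.1 hne
  rw [Finset.prod_eq_zero (Finset.mem_univ q), mul_zero]
  generalize Sum.elim x.1 x.2 q = i at *
  generalize Sum.elim y.1 y.2 q = j at *
  rcases hg q with h | h <;> rw [h] <;> fin_cases i <;> fin_cases j <;>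
    simp_all [Pauli.toMatrix]

/-- The state of an array with entries `1` and `X` is a mixture of the eigenvectors of the operators
`X` with equal weights. -/
lemma exists_weights {G : StabArray NA NB K} (hX : ∀ k q, (G k).op q = .I ∨ (G k).op q = .X)
    (hp : ∀ k, Pauli.parity (G k).phase = 0) : ∃ w : Bits NA × Bits NB → ℝ,
      (∀ x, w x = 0 ∨ w x = (2 : ℝ) ^ ((K : ℤ) - ((NA + NB : ℕ) : ℤ))) ∧
      G.state = (hadamardAll NA ⊗ₖ hadamardAll NB) * Matrix.diagonal (fun x => (w x : ℂ)) *
        (hadamardAll NA ⊗ₖ hadamardAll NB)ᴴ := by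
  -- The image of the array under Hadamard gates on all qubits: `X` becomes `Z`, so everything is
  -- diagonal and each projector has diagonal entries 0 or 1.
  let D : StabArray NA NB K := fun k =>
    ⟨(G k).phase, fun q => if (G k).op q = .X then .Z else .I⟩
  have hD : ∀ k, (D k).toMatrix = Matrix.diagonal fun x => (D k).toMatrix x x := by
    intro k
    refine toMatrix_eq_diagonal fun q => ?_
    by_cases h : (G k).op q = .X <;> simp [D, h]
  have hone : ∀ k x, (D k).toMatrix x x = 1 ∨ (D k).toMatrix x x = -1 := by
    intro k x
    have h := StabOp.toMatrix_sq (g := D k) (hp k)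
    rw [hD k, Matrix.diagonal_mul_diagonal] at h
    have := congrFun (congrFun h x) x
    simp only [Matrix.diagonal_apply_eq, Matrix.one_apply_eq] at this
    exact mul_self_eq_one_iff.1 this
  have hfac : ∀ k x, (2⁻¹ : ℂ) * (1 + (D k).toMatrix x x) = 0 ∨
      (2⁻¹ : ℂ) * (1 + (D k).toMatrix x x) = 1 := by
    intro k x
    rcases hone k x with h | h <;> rw [h]
    · right; norm_num
    · left; norm_num
  have hstate : D.state = Matrix.diagonal fun x => (2 : ℂ) ^ ((K : ℤ) - ((NA + NB : ℕ) : ℤ)) *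
      ∏ k, (2⁻¹ : ℂ) * (1 + (D k).toMatrix x x) := by
    have h1 : ∀ k, (2⁻¹ : ℂ) • (1 + (D k).toMatrix) =
        Matrix.diagonalRingHom (Bits NA × Bits NB) ℂ
          fun x => (2⁻¹ : ℂ) * (1 + (D k).toMatrix x x) := by
      intro k
      ext x y
      by_cases hxy : x = y
      · subst hxy; simp
      · have : (D k).toMatrix x y = 0 := by rw [hD k]; exact Matrix.diagonal_apply_ne _ hxy
        simp [hxy, this]
    unfold state
    simp only [h1]
    rw [show (List.ofFn fun k => Matrix.diagonalRingHom (Bits NA × Bits NB) ℂ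
      fun x => (2⁻¹ : ℂ) * (1 + (D k).toMatrix x x)) = List.map (Matrix.diagonalRingHom _ ℂ)
      (List.ofFn fun k x => (2⁻¹ : ℂ) * (1 + (D k).toMatrix x x)) by rw [List.map_ofFn]; rfl,
      ← map_list_prod, List.prod_ofFn]
    ext x y
    by_cases hxy : x = y
    · subst hxy; simp
    · simp [hxy]
  have hw : ∀ x, ∃ w : ℝ, (w = 0 ∨ w = (2 : ℝ) ^ ((K : ℤ) - ((NA + NB : ℕ) : ℤ))) ∧
      (w : ℂ) = (2 : ℂ) ^ ((K : ℤ) - ((NA + NB : ℕ) : ℤ)) *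
        ∏ k, (2⁻¹ : ℂ) * (1 + (D k).toMatrix x x) := by
    intro x
    by_cases h : ∃ k, (2⁻¹ : ℂ) * (1 + (D k).toMatrix x x) = 0
    · obtain ⟨k, hk⟩ := h
      exact ⟨0, .inl rfl, by rw [Finset.prod_eq_zero (Finset.mem_univ k) hk]; simp⟩
    · push Not at h
      exact ⟨_, .inr rfl, by
        rw [Finset.prod_eq_one fun k _ => (hfac k x).resolve_left (h k)]; push_cast; simp⟩
  choose w hw hw' using hw
  refine ⟨w, hw, ?_⟩
  have hU := hadamardAll_unitary NA
  have hV := hadamardAll_unitary NB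
  have hW : hadamardAll NA ⊗ₖ hadamardAll NB = qubitTensor fun _ : Qubit NA NB =>
    ((√2 : ℝ) : ℂ)⁻¹ • !![(1 : ℂ), 1; 1, -1] := rfl
  rw [state_conj (kronecker_unitary hU hV)
    (kronecker_unitary' (mul_eq_one_comm.1 hU) (mul_eq_one_comm.1 hV)) (G := D) fun k => ?_]
  · rw [hstate]
    simp only [hw']
  · rw [hW]
    refine StabOp.toMatrix_conj _ 0 (fun q => ?_) (by simp [D])
    rw [hadamard_conjTranspose]
    rcases hX k q with h | h
    · simp only [D, h, Pauli.toMatrix, mul_one, hadamard_mul_self, Pi.zero_apply, iPow_zero,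
        one_smul, reduceCtorEq, if_false]
    · simp only [D, h, if_true, Pi.zero_apply, iPow_zero, one_smul]
      rw [hadamard_Z, mul_assoc, hadamard_mul_self, mul_one]

/-! ### Product mixtures and separability -/

/-- A mixture of pure product states. -/
def _root_.IsProductMixture {a b : Type} [Fintype a] [Fintype b]
    (ρ : Matrix (a × b) (a × b) ℂ) : Prop :=
  ∃ (n : ℕ) (w : Fin n → ℝ) (u : Fin n → a → ℂ) (v : Fin n → b → ℂ),
    (∀ i, 0 ≤ w i) ∧ ∑ i, w i = 1 ∧ (∀ i, star (u i) ⬝ᵥ u i = 1) ∧ (∀ i, star (v i) ⬝ᵥ v i = 1) ∧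
      ρ = ∑ i, (w i : ℂ) •
        (Matrix.vecMulVec (u i) (star (u i)) ⊗ₖ Matrix.vecMulVec (v i) (star (v i)))

lemma _root_.isDensity_vecMulVec {a : Type} [Fintype a] {u : a → ℂ} (hu : star u ⬝ᵥ u = 1) :
    IsDensity (Matrix.vecMulVec u (star u)) :=
  ⟨Matrix.posSemidef_vecMulVec_self_star u, by rw [Matrix.trace_vecMulVec, dotProduct_comm, hu]⟩

lemma _root_.IsProductMixture.isSeparableState {a b : Type} [Fintype a] [Fintype b]
    {ρ : Matrix (a × b) (a × b) ℂ} (h : IsProductMixture ρ) : IsSeparableState ρ := by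
  obtain ⟨n, w, u, v, hw, hw1, hu, hv, h⟩ := h
  exact ⟨n, w, _, _, hw, hw1, fun i => isDensity_vecMulVec (hu i),
    fun i => isDensity_vecMulVec (hv i), h⟩

lemma _root_.IsSeparableState.isDensity {a b : Type} [Fintype a] [Fintype b]
    {ρ : Matrix (a × b) (a × b) ℂ} (h : IsSeparableState ρ) : IsDensity ρ := by
  obtain ⟨n, w, σ, τ, hw, hw1, hσ, hτ, rfl⟩ := h
  refine ⟨Matrix.posSemidef_sum _ fun i _ => ((hσ i).1.kronecker (hτ i).1).smul ?_, ?_⟩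
  · exact_mod_cast hw i
  · simp only [Matrix.trace_sum, Matrix.trace_smul, Matrix.trace_kronecker, (hσ _).2, (hτ _).2]
    simp only [mul_one, smul_eq_mul]
    exact_mod_cast hw1

section XType

variable {G : StabArray NA NB K}

lemma isXDiagonal_state (hX : ∀ k q, (G k).op q = .I ∨ (G k).op q = .X)
    (hp : ∀ k, Pauli.parity (G k).phase = 0) : IsXDiagonal G.state := by
  obtain ⟨w, -, h⟩ := exists_weights hX hp
  have hW := kronecker_unitary (hadamardAll_unitary NA) (hadamardAll_unitary NB)
  rw [IsXDiagonal, h]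
  generalize hadamardAll NA ⊗ₖ hadamardAll NB = W at *
  rw [mul_assoc, mul_assoc, hW, mul_one, ← mul_assoc, hW, one_mul]
  exact Matrix.isDiag_diagonal _

lemma exists_weights_sum (hX : ∀ k q, (G k).op q = .I ∨ (G k).op q = .X)
    (hp : ∀ k, Pauli.parity (G k).phase = 0) (ht : G.state.trace = 1) :
    ∃ w : Bits NA × Bits NB → ℝ,
      (∀ x, w x = 0 ∨ w x = (2 : ℝ) ^ ((K : ℤ) - ((NA + NB : ℕ) : ℤ))) ∧
      (∀ x, 0 ≤ w x) ∧ ∑ x, w x = 1 ∧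
      G.state = (hadamardAll NA ⊗ₖ hadamardAll NB) * Matrix.diagonal (fun x => (w x : ℂ)) *
        (hadamardAll NA ⊗ₖ hadamardAll NB)ᴴ := by
  obtain ⟨w, hw, h⟩ := exists_weights hX hp
  refine ⟨w, hw, fun x => ?_, ?_, h⟩
  · rcases hw x with h | h <;> rw [h]
    positivity
  · rw [h, Matrix.trace_mul_comm, ← mul_assoc,
      kronecker_unitary (hadamardAll_unitary NA) (hadamardAll_unitary NB), one_mul,
      Matrix.trace_diagonal] at ht
    exact_mod_cast ht

/-- Some probability is nonzero, hence equal to the fixed power of 2, and no probability exceeds 1.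
-/
lemma card_rows_le (hX : ∀ k q, (G k).op q = .I ∨ (G k).op q = .X)
    (hp : ∀ k, Pauli.parity (G k).phase = 0) (ht : G.state.trace = 1) : K ≤ NA + NB := by
  obtain ⟨w, hw, hw0, hw1, -⟩ := exists_weights_sum hX hp ht
  obtain ⟨x, hx⟩ : ∃ x, w x ≠ 0 := by
    by_contra! hc
    simp [hc] at hw1
  have h1 : w x ≤ 1 := hw1 ▸ Finset.single_le_sum (fun x _ => hw0 x) (Finset.mem_univ x)
  rw [(hw x).resolve_left hx] at h1
  have := (zpow_le_one_iff_right₀ (by norm_num : (1 : ℝ) < 2)).1 h1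
  omega

/-- The eigenvectors are products of columns of the Hadamard matrices of A and B. Pure factors are
recorded since `le_biTensor` prepares them by isometries. -/
lemma isProductMixture_state (hX : ∀ k q, (G k).op q = .I ∨ (G k).op q = .X)
    (hp : ∀ k, Pauli.parity (G k).phase = 0) (ht : G.state.trace = 1) :
    IsProductMixture G.state := by
  obtain ⟨w, -, hw0, hw1, h⟩ := exists_weights_sum hX hp ht
  let e := (Fintype.equivFin (Bits NA × Bits NB)).symm
  have unit : ∀ n (x : Bits n), star (fun i => hadamardAll n i x) ⬝ᵥ
      (fun i => hadamardAll n i x) = 1 := fun n x => by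
    have := congrFun (congrFun (hadamardAll_unitary n) x) x
    rwa [Matrix.one_apply_eq, Matrix.mul_apply] at this
  refine ⟨_, w ∘ e, fun i j => hadamardAll NA j (e i).1, fun i j => hadamardAll NB j (e i).2,
    fun i => hw0 _, (Equiv.sum_comp e w).trans hw1, fun i => unit _ _, fun i => unit _ _, ?_⟩
  rw [h, Function.comp_def, Equiv.sum_comp e fun x => (w x : ℂ) •
    (Matrix.vecMulVec (fun j => hadamardAll NA j x.1) (star fun j => hadamardAll NA j x.1) ⊗ₖ
      Matrix.vecMulVec (fun j => hadamardAll NB j x.2) (star fun j => hadamardAll NB j x.2))]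
  ext i j
  rw [Matrix.mul_apply, Matrix.sum_apply]
  refine Finset.sum_congr rfl fun x _ => ?_
  simp [Matrix.mul_diagonal, Matrix.vecMulVec_apply, Matrix.conjTranspose_apply]
  ring

end XType

end StabArray

/-! ## Entanglement measures -/

lemma isDensity_EPR : IsDensity EPR :=
  ⟨Matrix.posSemidef_vecMulVec_self_star _, trace_EPR⟩

lemma isDensity_biPow_EPR (p : ℕ) : IsDensity (biPow p EPR) := by
  refine ⟨?_, by rw [biPow, trace_biProd]; simp [trace_EPR]⟩
  have : biPow p EPR = Matrix.vecMulVec (fun x => ∏ i, eprVec (x.1 i, x.2 i))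
      (star fun x => ∏ i, eprVec (x.1 i, x.2 i)) := by
    ext x y
    simp [biPow, biProd, EPR, Matrix.vecMulVec_apply, Finset.prod_mul_distrib]
  rw [this]
  exact Matrix.posSemidef_vecMulVec_self_star _

lemma IsDensity.biTensor {a b a' b' : Type} [Fintype a] [Fintype b] [Fintype a'] [Fintype b']
    {ρ : Matrix (a × b) (a × b) ℂ} {σ : Matrix (a' × b') (a' × b') ℂ} (hρ : IsDensity ρ)
    (hσ : IsDensity σ) : IsDensity (biTensor ρ σ) :=
  ⟨(hρ.1.kronecker hσ.1).submatrix (Equiv.prodProdProdComm a a' b b'),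
    by rw [trace_biTensor, hρ.2, hσ.2, mul_one]⟩

/-- The isometry that adjoins a system in the state `u`. -/
def adjoinVec (a : Type) {a' : Type} [DecidableEq a] (u : a' → ℂ) : Matrix (a × a') a ℂ :=
  Matrix.of fun x y => (1 : Matrix a a ℂ) x.1 y * u x.2

lemma adjoinVec_isometry {a a' : Type} [Fintype a] [DecidableEq a] [Fintype a']
    {u : a' → ℂ} (hu : star u ⬝ᵥ u = 1) :
    (adjoinVec a u)ᴴ * adjoinVec a u = 1 := by
  ext x y
  simp only [adjoinVec, Matrix.mul_apply, Matrix.conjTranspose_apply, Matrix.of_apply,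
    Fintype.sum_prod_type]
  have : ∀ z, ∑ i, star ((1 : Matrix a a ℂ) z x * u i) * ((1 : Matrix a a ℂ) z y * u i) =
      star ((1 : Matrix a a ℂ) z x) * (1 : Matrix a a ℂ) z y := by
    intro z
    rw [← mul_one (star _ * _), ← hu, dotProduct, Finset.mul_sum]
    refine Finset.sum_congr rfl fun i _ => ?_
    simp only [star_mul', Pi.star_apply]
    ring
  simp only [this]
  have h := congrFun (congrFun (Matrix.one_mul (1 : Matrix a a ℂ)) x) y
  rw [← h, Matrix.mul_apply]
  refine Finset.sum_congr rfl fun z _ => ?_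
  congr 1
  by_cases hz : z = x
  · subst hz; simp
  · simp [hz, Ne.symm hz]

lemma adjoinVec_kronecker_apply {a b a' b' : Type} [Fintype a] [DecidableEq a] [Fintype b]
    [DecidableEq b] (u : a' → ℂ) (v : b' → ℂ) (ρ : Matrix (a × b) (a × b) ℂ) :
    (adjoinVec a u ⊗ₖ adjoinVec b v) * ρ * (adjoinVec a u ⊗ₖ adjoinVec b v)ᴴ =
      biTensor ρ (Matrix.vecMulVec u (star u) ⊗ₖ Matrix.vecMulVec v (star v)) := by
  ext ⟨⟨x, x'⟩, ⟨y, y'⟩⟩ ⟨⟨z, z'⟩, ⟨t, t'⟩⟩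
  simp only [Matrix.mul_apply, Matrix.conjTranspose_apply, Matrix.kroneckerMap_apply, adjoinVec,
    Matrix.of_apply, Matrix.one_apply, biTensor, Matrix.vecMulVec_apply, Pi.star_apply,
    Fintype.sum_prod_type]
  simp only [ite_mul, one_mul, zero_mul, mul_ite, mul_zero, apply_ite (star : ℂ → ℂ), star_zero,
    Finset.sum_ite_eq, Finset.mem_univ, if_true, star_mul']
  simp
  ring

/-- The operator that projects the second system to a basis state. -/
def projectTo (a : Type) {a' : Type} [DecidableEq a] [DecidableEq a'] (k : a') :
    Matrix a (a × a') ℂ :=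
  Matrix.of fun x y => (1 : Matrix a a ℂ) x y.1 * (1 : Matrix a' a' ℂ) k y.2

lemma sum_projectTo {a a' : Type} [Fintype a] [DecidableEq a] [Fintype a'] [DecidableEq a'] :
    ∑ k : a', (projectTo a k)ᴴ * projectTo a k = 1 := by
  ext ⟨x, x'⟩ ⟨y, y'⟩
  simp only [Matrix.sum_apply, Matrix.mul_apply, Matrix.conjTranspose_apply, projectTo,
    Matrix.of_apply, Matrix.one_apply, apply_ite (star : ℂ → ℂ), star_one, star_zero, mul_ite,
    mul_one, mul_zero, Prod.mk.injEq]
  by_cases h1 : x = y <;> by_cases h2 : x' = y' <;> simp_all [eq_comm]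

/-- Summed over `k` and `l`, this gives the partial trace over the second systems. -/
lemma partialTrace_apply {a b a' b' : Type} [Fintype a] [DecidableEq a] [Fintype b]
    [DecidableEq b] [Fintype a'] [DecidableEq a'] [Fintype b'] [DecidableEq b'] (k : a') (l : b')
    (ρ : Matrix (a × b) (a × b) ℂ) (σ : Matrix (a' × b') (a' × b') ℂ) :
    (projectTo a k ⊗ₖ projectTo b l) * biTensor ρ σ * (projectTo a k ⊗ₖ projectTo b l)ᴴ =
      σ (k, l) (k, l) • ρ := by
  ext ⟨x, y⟩ ⟨z, t⟩
  simp only [Matrix.mul_apply, Matrix.conjTranspose_apply, Matrix.kroneckerMap_apply, projectTo,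
    Matrix.of_apply, Matrix.one_apply, biTensor, Fintype.sum_prod_type, Matrix.smul_apply]
  simp only [ite_mul, one_mul, zero_mul, mul_ite, mul_zero, mul_one, apply_ite (star : ℂ → ℂ),
    star_zero, star_one, Finset.sum_ite_eq, Finset.mem_univ, if_true]
  simp
  ring

namespace IsEntanglementMeasure

variable {E : BipartiteFunction} {a b a' b' : Type} [Fintype a] [DecidableEq a] [Fintype b]
  [DecidableEq b] [Fintype a'] [Fintype b']

lemma le_of_locallyEquivalent [DecidableEq a'] [DecidableEq b'] (hE : IsEntanglementMeasure E)
    {ρ : Matrix (a × b) (a × b) ℂ}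
    {σ : Matrix (a' × b') (a' × b') ℂ} (h : LocallyEquivalent ρ σ) (hρ : IsDensity ρ) :
    E a' b' σ ≤ E a b ρ := by
  obtain ⟨U, V, h1, -, h3, -, rfl⟩ := h
  refine hE.locc a b a' b' (fun ρ => (U ⊗ₖ V) * ρ * (U ⊗ₖ V)ᴴ) (.oneWayAB _ ?_) ρ hρ
  exact ⟨1, 1, fun _ => U, fun _ _ => V, by simpa using h1, by simpa using h3, by simp⟩

lemma eq_of_locallyEquivalent [DecidableEq a'] [DecidableEq b'] (hE : IsEntanglementMeasure E)
    {ρ : Matrix (a × b) (a × b) ℂ}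
    {σ : Matrix (a' × b') (a' × b') ℂ} (h : LocallyEquivalent ρ σ) (hρ : IsDensity ρ) :
    E a' b' σ = E a b ρ :=
  le_antisymm (hE.le_of_locallyEquivalent h hρ)
    (hE.le_of_locallyEquivalent h.symm (h.isDensity hρ))

/-- A draws `i` with probability `w i`, adjoins `u i` and announces `i`; B adjoins `v i`. The square
roots of the weights serve as Kraus coefficients. -/
lemma le_biTensor (hE : IsEntanglementMeasure E) {ρ : Matrix (a × b) (a × b) ℂ}
    {σ : Matrix (a' × b') (a' × b') ℂ} (hρ : IsDensity ρ) (hσ : IsProductMixture σ) :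
    E _ _ (biTensor ρ σ) ≤ E a b ρ := by
  obtain ⟨n, w, u, v, hw, hw1, hu, hv, rfl⟩ := hσ
  have hsq : ∀ i, ((√(w i) : ℝ) : ℂ) * ((√(w i) : ℝ) : ℂ) = (w i : ℂ) := fun i => by
    rw [← Complex.ofReal_mul, Real.mul_self_sqrt (hw i)]
  refine hE.locc a b (a × a') (b × b') (fun ρ => biTensor ρ _) (.oneWayAB _ ?_) ρ hρ
  refine ⟨n, 1, fun i => ((√(w i) : ℝ) : ℂ) • adjoinVec a (u i), fun i _ => adjoinVec b (v i), ?_,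
    fun i => by simpa using adjoinVec_isometry (hv i), fun ρ => ?_⟩
  · simp only [Matrix.conjTranspose_smul, Matrix.smul_mul, Matrix.mul_smul, smul_smul,
      adjoinVec_isometry (hu _),
      Complex.star_def, Complex.conj_ofReal, hsq, ← Finset.sum_smul]
    rw [← Complex.ofReal_sum, hw1, Complex.ofReal_one, one_smul]
  · simp only [Finset.univ_unique, Finset.sum_singleton, Matrix.smul_kronecker,
      Matrix.conjTranspose_smul, Matrix.smul_mul, Matrix.mul_smul, smul_smul,
      adjoinVec_kronecker_apply, Complex.star_def, Complex.conj_ofReal, hsq]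
    ext x y
    simp only [biTensor, Matrix.of_apply, Matrix.sum_apply, Matrix.smul_apply, Finset.mul_sum,
      smul_eq_mul]
    exact Finset.sum_congr rfl fun i _ => by ring

/-- Both parties discard their second systems; B ignores the outcome of A. -/
lemma biTensor_le [DecidableEq a'] [DecidableEq b'] (hE : IsEntanglementMeasure E)
    {ρ : Matrix (a × b) (a × b) ℂ}
    {σ : Matrix (a' × b') (a' × b') ℂ} (hρ : IsDensity ρ) (hσ : IsDensity σ) :
    E a b ρ ≤ E _ _ (biTensor ρ σ) := by
  let e := (Fintype.equivFin a').symm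
  let f := (Fintype.equivFin b').symm
  let Λ : Matrix ((a × a') × (b × b')) ((a × a') × (b × b')) ℂ → Matrix (a × b) (a × b) ℂ :=
    fun τ => ∑ k, ∑ l, (projectTo a (e k) ⊗ₖ projectTo b (f l)) * τ *
      (projectTo a (e k) ⊗ₖ projectTo b (f l))ᴴ
  have hΛ : Λ (biTensor ρ σ) = ρ := by
    simp only [Λ, partialTrace_apply, ← Finset.sum_smul]
    rw [Equiv.sum_comp e fun k => ∑ l, σ (k, f l) (k, f l)]
    simp only [fun k => Equiv.sum_comp f fun l => σ (k, l) (k, l)]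
    have h := hσ.2
    rw [Matrix.trace, Fintype.sum_prod_type] at h
    simp only [Matrix.diag_apply] at h
    rw [h, one_smul]
  have := hE.locc (a × a') (b × b') a b Λ (.oneWayAB _ ⟨_, _, fun k => projectTo a (e k),
    fun _ l => projectTo b (f l),
    by rw [Equiv.sum_comp e fun k => (projectTo a k)ᴴ * projectTo a k, sum_projectTo],
    fun _ => by
      rw [Equiv.sum_comp f fun k => (projectTo b k)ᴴ * projectTo b k, sum_projectTo],
    fun _ => rfl⟩) _ (hρ.biTensor hσ)
  rwa [hΛ] at this

lemma biTensor_eq [DecidableEq a'] [DecidableEq b'] (hE : IsEntanglementMeasure E)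
    {ρ : Matrix (a × b) (a × b) ℂ}
    {σ : Matrix (a' × b') (a' × b') ℂ} (hρ : IsDensity ρ) (hσ : IsProductMixture σ) :
    E _ _ (_root_.biTensor ρ σ) = E a b ρ :=
  le_antisymm (hE.le_biTensor hρ hσ) (hE.biTensor_le hρ hσ.isSeparableState.isDensity)

end IsEntanglementMeasure

/-! ## Generators that attain the bound -/

namespace StabArray

variable {NA NB K : ℕ}

/-- Commuting rows are independent if there are operators each of which anticommutes with exactly
one of them. -/
lemma IsCommuting.isGeneratorSet {G : StabArray NA NB K} (hG : G.IsCommuting)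
    (d : Fin K → StabOp NA NB)
    (hd : ∀ k l, StabOp.form Finset.univ (d k) (G l) = if k = l then 1 else 0) :
    G.IsGeneratorSet := by
  have heven : ∀ s : Fin K → ℕ, (∀ k, Even (s k)) →
      (List.ofFn fun k => (G k).toMatrix ^ s k).prod = 1 := by
    intro s hs
    refine List.prod_eq_one fun M hM => ?_
    obtain ⟨k, rfl⟩ := (List.mem_ofFn' _ _).1 hM
    obtain ⟨n, hn⟩ := hs k
    simp only
    rw [hn, ← two_mul, pow_mul, pow_two, StabOp.toMatrix_sq (hG.parity k), one_pow]
  -- A scalar commutes with `d k`, but the product anticommutes with it if `s k` is odd. Both values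
  -- `c = 1` and `c = -1` are needed below.
  have hodd : ∀ (s : Fin K → ℕ) (c : ℂ), c ≠ 0 →
      (List.ofFn fun k => (G k).toMatrix ^ s k).prod = c • 1 → ∀ k, Even (s k) := by
    intro s c hc hs k
    by_contra hk
    have hrow : ∀ l, (d k).toMatrix * (G l).toMatrix ^ s l =
        (if k = l then (-1 : ℂ) else 1) • ((G l).toMatrix ^ s l * (d k).toMatrix) := by
      intro l
      have h1 := StabOp.toMatrix_comm (d k) (G l)
      rw [hd] at h1
      by_cases hkl : k = l
      · subst hkl
        have h2 : SemiconjBy (d k).toMatrix (G k).toMatrix (-(G k).toMatrix) := by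
          rw [SemiconjBy, h1, if_pos rfl, signOf, if_neg (by decide), neg_one_smul, neg_mul]
        have h3 := h2.pow_right (s k)
        rw [Odd.neg_pow (Nat.not_even_iff_odd.1 hk)] at h3
        rw [h3.eq, if_pos rfl, neg_one_smul, neg_mul]
      · rw [if_neg hkl, signOf, if_pos rfl, one_smul] at h1
        rw [if_neg hkl, one_smul]
        exact (Commute.pow_right h1 (s l)).eq
    have hlist : ∀ L : List (Fin K), (d k).toMatrix * (L.map fun l => (G l).toMatrix ^ s l).prod =
        (L.map fun l => if k = l then (-1 : ℂ) else 1).prod •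
          ((L.map fun l => (G l).toMatrix ^ s l).prod * (d k).toMatrix) := by
      intro L
      induction L with
      | nil => simp
      | cons l L ih =>
        simp only [List.map_cons, List.prod_cons]
        rw [← mul_assoc, hrow, smul_mul_assoc, mul_assoc _ (d k).toMatrix, ih, mul_smul_comm,
          smul_smul, mul_assoc]
    have h1 := hlist (List.finRange K)
    rw [← List.ofFn_eq_map, ← List.ofFn_eq_map, hs, List.prod_ofFn, Finset.prod_ite_eq,
      if_pos (Finset.mem_univ k), mul_smul_comm, smul_mul_assoc, mul_one, one_mul, neg_one_smul,
      eq_neg_iff_add_eq_zero, ← two_smul ℂ, smul_smul,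
      smul_eq_zero_iff_right (mul_ne_zero two_ne_zero hc)] at h1
    have h2 := StabOp.toMatrix_unitary (d k)
    rw [h1, mul_zero] at h2
    exact zero_ne_one h2
  refine ⟨fun k => (Pauli.parity_eq_zero_iff _).1 (hG.parity k), hG.commute,
    fun s => ⟨fun h => hodd s 1 one_ne_zero (by rw [h, one_smul]), heven s⟩, fun s h => ?_⟩
  -- If the product were -1, all exponents would be even and the product 1; the trace separates the
  -- two.
  rw [heven s (hodd s (-1) (by norm_num) (by rw [h, neg_one_smul]))] at h
  have := congrArg Matrix.trace h
  rw [Matrix.trace_neg, eq_neg_iff_add_eq_zero, ← two_mul, Matrix.trace_one] at this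
  simp at this

end StabArray

namespace StabArray

variable {NA NB K : ℕ}

/-- The position of a column among those from column `p` on of each party. -/
def lowerIndex (p : ℕ) : Qubit NA NB → ℕ
  | .inl i => i - p
  | .inr j => NA - p + (j - p)

/-- The array in normal form with `p` pairs whose lower rows have a single entry `X`. -/
def standardForm (NA NB K p : ℕ) : StabArray NA NB K := fun k =>
  { phase := 0
    op := fun q =>
      if (k : ℕ) < 2 * p then
        if q.pos = (k : ℕ) / 2 then (if (k : ℕ) % 2 = 0 then .X else .Z) else .I
      else if p ≤ q.pos ∧ 2 * p + lowerIndex p q = k then .X else .I }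

lemma standardForm_normalForm {p : ℕ} (hK : 2 * p ≤ K) (hA : p ≤ NA) (hB : p ≤ NB) :
    (standardForm NA NB K p).NormalForm p := by
  refine ⟨hK, hA, hB, fun k q hk => if_pos hk, fun k q hk hq => ?_, fun k q hk hq => ?_⟩
  · simp [standardForm, not_lt.2 hk, not_le.2 hq]
  · simp only [standardForm, not_lt.2 hk, if_false]
    split_ifs <;> simp

/-- Rows of the same pair meet in one column at A and one at B, and the equal contributions `v`
cancel modulo 2. Any other two rows have disjoint supports or only entries `1` and `X`. -/
lemma standardForm_isCommuting {p : ℕ} (hA : p ≤ NA) (hB : p ≤ NB) :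
    (standardForm NA NB K p).IsCommuting := by
  refine ⟨fun _ => map_zero _, fun k l => ?_⟩
  by_cases hkl : (k : ℕ) < 2 * p ∧ (l : ℕ) < 2 * p
  · obtain ⟨v, hv⟩ : ∃ v : ZMod 2, ∀ q : Qubit NA NB, ((standardForm NA NB K p k).op q).anti
        ((standardForm NA NB K p l).op q) = if q.pos = (k : ℕ) / 2 then v else 0 := by
      simp only [standardForm, hkl.1, hkl.2, if_true]
      by_cases h : (k : ℕ) / 2 = (l : ℕ) / 2
      · refine ⟨Pauli.anti (if (k : ℕ) % 2 = 0 then .X else .Z)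
          (if (l : ℕ) % 2 = 0 then .X else .Z), fun q => ?_⟩
        rw [← h]
        by_cases hq : q.pos = (k : ℕ) / 2
        · simp only [hq, if_true]
        · simp [hq]
      · refine ⟨0, fun q => ?_⟩
        by_cases hq : q.pos = (k : ℕ) / 2
        · simp [hq, h]
        · simp [hq]
    have h1 : ∀ n, p ≤ n → ∑ i : Fin n, (if (i : ℕ) = (k : ℕ) / 2 then v else 0) = v := by
      intro n hn
      rw [Finset.sum_eq_single (⟨(k : ℕ) / 2, by omega⟩ : Fin n)]
      · simp
      · intro i _ hi
        exact if_neg fun h => hi (Fin.ext h)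
      · simp
    rw [StabOp.form, Finset.sum_congr rfl fun q _ => hv q, Fintype.sum_sum_type]
    exact (congrArg₂ _ (h1 NA hA) (h1 NB hB)).trans (CharTwo.add_self_eq_zero v)
  · refine Finset.sum_eq_zero fun q _ => ?_
    simp only [standardForm]
    split_ifs <;> first | rfl | (exfalso; omega)

lemma standardForm_isGeneratorSet {p : ℕ} (hK : 2 * p ≤ K) (hKN : K ≤ NA + NB) (hA : p ≤ NA)
    (hB : p ≤ NB) : (standardForm NA NB K p).IsGeneratorSet := by
  -- One-qubit operators suffice: for a pair row, the other Pauli operator of the pair on the qubit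
  -- of A; for a lower row, `Z` at its `X`.
  have hdual : ∀ k : Fin K, ∃ (q : Qubit NA NB) (a : Pauli), ∀ l : Fin K,
      a.anti ((standardForm NA NB K p l).op q) = if k = l then 1 else 0 := by
    intro k
    by_cases hk : (k : ℕ) < 2 * p
    · refine ⟨.inl ⟨(k : ℕ) / 2, by omega⟩, if (k : ℕ) % 2 = 0 then .Z else .X, fun l => ?_⟩
      by_cases hl : (l : ℕ) < 2 * p
      · rw [(standardForm_normalForm hK hA hB).pair_rows l _ hl]
        simp only [Qubit.pos, Fin.ext_iff]
        rcases Nat.mod_two_eq_zero_or_one (k : ℕ) with hk2 | hk2 <;>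
          rcases Nat.mod_two_eq_zero_or_one (l : ℕ) with hl2 | hl2 <;>
          simp only [hk2, hl2, one_ne_zero, if_true, if_false] <;>
          split_ifs <;> first | rfl | (exfalso; omega)
      · have hkl : k ≠ l := by rintro rfl; exact hl hk
        rw [(standardForm_normalForm hK hA hB).lower_left l _ (not_lt.1 hl)
          (by simp only [Qubit.pos]; omega), Pauli.anti_I_right, if_neg hkl]
    · obtain ⟨q, hq, hqk⟩ : ∃ q : Qubit NA NB, p ≤ q.pos ∧ 2 * p + lowerIndex p q = k := by
        by_cases h : (k : ℕ) - p < NA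
        -- The lower rows use up the columns `p, …, NA - 1` of A and continue with those of B from
        -- `p` on; `K ≤ NA + NB` ensures that there are enough.
        · exact ⟨.inl ⟨(k : ℕ) - p, h⟩, by simp [Qubit.pos]; omega, by simp [lowerIndex]; omega⟩
        · exact ⟨.inr ⟨(k : ℕ) - NA, by omega⟩, by simp [Qubit.pos]; omega,
            by simp [lowerIndex]; omega⟩
      refine ⟨q, .Z, fun l => ?_⟩
      simp only [standardForm, Fin.ext_iff, hqk]
      split_ifs <;> first | rfl | (exfalso; omega)
  choose q a h using hdual
  refine (standardForm_isCommuting hA hB).isGeneratorSet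
    (fun k => ⟨0, fun r => if r = q k then a k else .I⟩) fun k l => ?_
  rw [form_eq_of_single (Finset.mem_univ (q k)) fun _ _ => rfl, h]

/-! ### The lower block and the local equivalence class of a normal form -/

section NormalForm

variable {p : ℕ} {G : StabArray NA NB K}

lemma NormalForm.lowerBlock_op (hN : G.NormalForm p) (k : Fin (K - 2 * p))
    (q : Qubit (NA - p) (NB - p)) :
    (G.lowerBlock p k).op q = .I ∨ (G.lowerBlock p k).op q = .X := by
  rcases q with q | q <;> exact hN.lower_right _ _ (by simp) (by simp [Qubit.pos])

lemma NormalForm.locallyEquivalent_biTensor (hN : G.NormalForm p) (hG : G.IsCommuting) :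
    LocallyEquivalent G.state (biTensor (biPow p EPR) (G.lowerBlock p).state) := by
  have h1 : LocallyEquivalent G.state (splitQubits p G.state) :=
    locallyEquivalent_submatrix (joinEquiv hN.le_A) (joinEquiv hN.le_B) G.state
  rw [hN.splitQubits_state] at h1
  exact h1.trans (LocallyEquivalent.biTensor_left (LocallyEquivalent.biProd fun i =>
    pairState_locallyEquivalent (hG.parity _) (hG.parity _)) _)

/-- Traces multiply and the EPR factor has trace 1. Normalisation thus passes to the lower block
without a proof that its rows are independent. -/
lemma NormalForm.trace_lowerBlock (hN : G.NormalForm p) (hG : G.IsCommuting)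
    (ht : G.state.trace = 1) : (G.lowerBlock p).state.trace = 1 := by
  have h := (hN.locallyEquivalent_biTensor hG).trace_eq
  rw [trace_biTensor, (isDensity_biPow_EPR p).2, one_mul, ht] at h
  exact h

end NormalForm

end StabArray

theorem theorem1 (NA NB K : ℕ) (G : StabArray NA NB K) (hG : G.IsGeneratorSet) :
    -- the normal form can be reached, with phases `+1` in all `XZ` rows
    (∃ (p : ℕ) (G' : StabArray NA NB K), G.Reaches G' ∧ G'.NormalForm p ∧
      ∀ k : Fin K, (k : ℕ) < 2 * p → (G' k).phase = 0) ∧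
    -- every normal form that can be reached, with `p` the number of its `XZ` pairs
    (∀ (p : ℕ) (G' : StabArray NA NB K), G.Reaches G' → ∀ hN : G'.NormalForm p,
      -- its state: one pure EPR pair for each pair of rows, and a separable state
      (splitQubits p G'.state =
          biTensor
            (biProd fun i : Fin p => pairState (G'.pairPhase hN.two_mul_le i 0)
              (G'.pairPhase hN.two_mul_le i 1))
            (G'.lowerBlock p).state ∧
        (∀ i : Fin p, LocallyEquivalent
          (pairState (G'.pairPhase hN.two_mul_le i 0) (G'.pairPhase hN.two_mul_le i 1)) EPR ∧
          (G'.pairPhase hN.two_mul_le i 0 = 0 → G'.pairPhase hN.two_mul_le i 1 = 0 →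
            pairState (G'.pairPhase hN.two_mul_le i 0) (G'.pairPhase hN.two_mul_le i 1) = EPR)) ∧
        IsSeparableState (G'.lowerBlock p).state ∧ IsXDiagonal (G'.lowerBlock p).state) ∧
      -- the original state: local equivalence, entanglement, and the bound on `p`
      LocallyEquivalent G.state (biTensor (biPow p EPR) (G'.lowerBlock p).state) ∧
      (∀ E : BipartiteFunction, IsEntanglementMeasure E → IsAdditive E →
        E (Bits NA) (Bits NB) G.state = p * E (Fin 2) (Fin 2) EPR) ∧
      p ≤ min (K / 2) (min NA NB) ∧
      (p = K / 2 ∧ p = NA ∧ p = NB → K = 2 * NA ∧ K = 2 * NB)) ∧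
    -- the bound is attained for all values of `NA`, `NB`, `K`
    (∃ G₀ : StabArray NA NB K, G₀.IsGeneratorSet ∧
      G₀.NormalForm (min (K / 2) (min NA NB))) := by
  have hc := hG.isCommuting
  have facts : ∀ (p : ℕ) (G' : StabArray NA NB K), G.Reaches G' → G'.NormalForm p →
      G'.IsCommuting ∧ LocallyEquivalent G.state G'.state ∧ (G'.lowerBlock p).state.trace = 1 := by
    intro p G' hr hN
    have hc' := hc.reaches hr
    have he := hc.locallyEquivalent_reaches hr
    exact ⟨hc', he, hN.trace_lowerBlock hc' (by rw [he.trace_eq, hG.trace_state])⟩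
  obtain ⟨p₀, G₀, hr₀, hN₀, hph₀⟩ := hc.exists_normalForm
  -- The bound for the lower block reads `K - 2p ≤ (NA - p) + (NB - p)`.
  have hKN : K ≤ NA + NB := by
    obtain ⟨hc', -, ht⟩ := facts p₀ G₀ hr₀ hN₀
    have h := StabArray.card_rows_le hN₀.lowerBlock_op (fun k => hc'.parity _) ht
    have h1 := hN₀.two_mul_le
    have h2 := hN₀.le_A
    have h3 := hN₀.le_B
    omega
  refine ⟨⟨p₀, G₀, hr₀, hN₀, hph₀⟩, fun p G' hr hN => ?_, ?_⟩
  · obtain ⟨hc', he, ht⟩ := facts p G' hr hN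
    have hmix := StabArray.isProductMixture_state hN.lowerBlock_op (fun k => hc'.parity _) ht
    have hle := he.trans (hN.locallyEquivalent_biTensor hc')
    have h1 := hN.two_mul_le
    have h2 := hN.le_A
    have h3 := hN.le_B
    refine ⟨⟨hN.splitQubits_state, fun i => ⟨pairState_locallyEquivalent (hc'.parity _)
      (hc'.parity _), fun hs ht => by rw [hs, ht, pairState_zero]⟩, hmix.isSeparableState,
      StabArray.isXDiagonal_state hN.lowerBlock_op (fun k => hc'.parity _)⟩, hle,
      fun E hE hadd => ?_, by omega, by omega⟩
    have hEPR := isDensity_biPow_EPR p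
    rw [hE.eq_of_locallyEquivalent hle.symm (hEPR.biTensor hmix.isSeparableState.isDensity),
      hE.biTensor_eq hEPR hmix]
    exact hadd _ _ EPR isDensity_EPR p
  · exact ⟨_, StabArray.standardForm_isGeneratorSet (by omega) hKN (by omega) (by omega),
      StabArray.standardForm_normalForm (by omega) (by omega) (by omega)⟩
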